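/- Let $\mathrm{Top}$ be the category of (small) topological spaces with the open-cover Grothendieck topology. A continuous map $f\colon X\to Y$ *admits local sections* if $Y$ has an open cover over each member of which $f$ has a continuous section. A topological groupoid $[\mathcal G_1\rightrightarrows M]$ is a groupoid with spaces of objects and of arrows and continuous structure maps; no further conditions are imposed. A principal $\mathcal G$-bundle over a space $B$ is a continuous map $\pi\colon P\to B$ admitting local sections, with a continuous right action of $\mathcal G$ along a continuous map $a\colon P\to M$ such that $\pi(p\cdot\gamma)=\pi(p)$ and $P\times_{a,M,t}\mathcal G_1\to P\times_B P$, $(p,\gamma)\mapsto(p,p\cdot\gamma)$, is a homeomorphism. $B\mathcal G\to\mathrm{Top}$ is the category of principal $\mathcal G$-bundles (over arbitrary spaces) and equivariant continuous maps covering continuous maps of the bases. A topological stack is a stack in groupoids over $\mathrm{Top}$ equivalent to $B\mathcal G$ for some topological groupoid $\mathcal G$. A morphism of stacks $\Phi\colon\mathcal D\to\mathcal C$ is an *epimorphism* if for every space $U$ and morphism $q\colon\underline U\to\mathcal C$ there are an open cover $\{\sigma_\alpha\colon U_\alpha\to U\}$ and morphisms $q_\alpha\colon\underline{U_\alpha}\to\mathcal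 D$ with $\Phi\circ q_\alpha\cong q\circ\sigma_\alpha$ for all $\alpha$. A *gerbe* over a topological stack $\mathcal C$ is a morphism of topological stacks $\Phi\colon\mathcal D\to\mathcal C$ such that both $\Phi$ and its diagonal $\mathcal D\to\mathcal D\times_{\mathcal C}\mathcal D$ (2-fibre product) are epimorphisms. **Theorem.** Let $F\colon[\mathcal G_1\rightrightarrows M]\to[\mathcal H_1\rightrightarrows M]$ be a topological groupoid extension, that is, a continuous functor that is the identity on the space of objects $M$ and whose map $F\colon\mathcal G_1\to\mathcal H_1$ on arrows admits local sections. Then the associated morphism $B\mathcal G\to B\mathcal H$, which sends a principal $\mathcal G$-bundle $P$ to the principal $\mathcal H$-bundle $(P\times_{a,M,t}\mathcal H_1)/\mathcal G$ (quotient by $(p,\delta)\cdot\gamma=(p\cdot\gamma,F(\gamma)^{-1}\circ\delta)$, with $\mathcal H$ acting by $[p,\delta]\cdot\eta=[p,\delta\circ\eta]$), is a gerbe over the topological stack $B\mathcal H$: $B\mathcal G$ and $B\mathcal H$ are topological stacks, and both $B\mathcal G\to B\mathcal H$ and its diagonal $B\mathcal G\to B\mathcal G\times_{B\mathcal H}B\mathcal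 G$ are epimorphisms of stacks. -/

import Mathlib

open CategoryTheory Topology

universe u

/-- A continuous map of local sections: there is an open cover of the target over each member of
which there is a continuous section. -/
def HasLocalSections {X Y : Type*} [TopologicalSpace X] [TopologicalSpace Y] (f : X → Y) : Prop :=
  ∀ y : Y, ∃ V : Set Y, IsOpen V ∧ y ∈ V ∧ ∃ s : V → X, Continuous s ∧ ∀ v : V, f (s v) = v

/-- A topological groupoid `[Arr ⇉ M]`: a groupoid with a space `M` of objects and a space `Arr`
of arrows, all of whose structure maps are continuous. `comp g h` is the composite `g ∘ h`
(first `h`, then `g`). -/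
structure TopGroupoid (M : Type u) [TopologicalSpace M] where
  /-- The space of arrows. -/
  Arr : Type u
  [top : TopologicalSpace Arr]
  src : Arr → M
  tgt : Arr → M
  one : M → Arr
  inv : Arr → Arr
  comp : (g h : Arr) → src g = tgt h → Arr
  continuous_src : Continuous src
  continuous_tgt : Continuous tgt
  continuous_one : Continuous one
  continuous_inv : Continuous inv
  continuous_comp : Continuous fun x : {x : Arr × Arr // src x.1 = tgt x.2} ↦ comp x.1.1 x.1.2 x.2
  src_one : ∀ m, src (one m) = m
  tgt_one : ∀ m, tgt (one m) = m
  src_inv : ∀ g, src (inv g) = tgt g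
  tgt_inv : ∀ g, tgt (inv g) = src g
  src_comp : ∀ g h e, src (comp g h e) = src h
  tgt_comp : ∀ g h e, tgt (comp g h e) = tgt g
  assoc : ∀ g h k (e : src g = tgt h) (e' : src h = tgt k),
    comp (comp g h e) k ((src_comp g h e).trans e') =
      comp g (comp h k e') (e.trans (tgt_comp h k e').symm)
  one_comp : ∀ g, comp (one (tgt g)) g (src_one _) = g
  comp_one : ∀ g, comp g (one (src g)) (tgt_one _).symm = g
  inv_comp : ∀ g, comp (inv g) g (src_inv g) = one (src g)
  comp_inv : ∀ g, comp g (inv g) (tgt_inv g).symm = one (tgt g)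

namespace TopGroupoid

attribute [instance] TopGroupoid.top

/-- A morphism of topological groupoids: a continuous functor. -/
structure Hom {M N : Type u} [TopologicalSpace M] [TopologicalSpace N]
    (G : TopGroupoid M) (H : TopGroupoid N) where
  obj : M → N
  arr : G.Arr → H.Arr
  continuous_obj : Continuous obj
  continuous_arr : Continuous arr
  src_arr : ∀ g, H.src (arr g) = obj (G.src g)
  tgt_arr : ∀ g, H.tgt (arr g) = obj (G.tgt g)
  arr_one : ∀ m, arr (G.one m) = H.one (obj m)
  arr_inv : ∀ g, arr (G.inv g) = H.inv (arr g)
  arr_comp : ∀ g h (e : G.src g = G.tgt h),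
    arr (G.comp g h e) =
      H.comp (arr g) (arr h) ((src_arr g).trans ((congrArg obj e).trans (tgt_arr h).symm))

/-- A morphism of topological groupoids over the same space of objects is a *topological groupoid
extension* if it is the identity on objects and its map on arrows admits local sections. -/
structure Hom.IsExtension {M : Type u} [TopologicalSpace M] {G H : TopGroupoid M}
    (F : Hom G H) : Prop where
  obj_eq : ∀ m, F.obj m = m
  hasLocalSections : HasLocalSections F.arr

section

variable {M : Type u} [TopologicalSpace M] (G : TopGroupoid M)

theorem one_comp' {m : M} {g : G.Arr} (e : G.src (G.one m) = G.tgt g) :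
    G.comp (G.one m) g e = g := by
  obtain rfl : m = G.tgt g := by rw [← e, G.src_one]
  exact G.one_comp g

theorem inv_comp_cancel {g h : G.Arr} (e : G.src g = G.tgt h) :
    G.comp (G.inv g) (G.comp g h e) ((G.src_inv g).trans (G.tgt_comp g h e).symm) = h := by
  rw [← G.assoc (G.inv g) g h (G.src_inv g) e]
  simp only [G.inv_comp]
  exact G.one_comp' _

theorem comp_inv_cancel {g h : G.Arr} (e : G.tgt g = G.tgt h) :
    G.comp g (G.comp (G.inv g) h ((G.src_inv g).trans e))
      ((G.tgt_inv g).symm.trans (G.tgt_comp _ _ _).symm) = h := by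
  rw [← G.assoc g (G.inv g) h (G.tgt_inv g).symm ((G.src_inv g).trans e)]
  simp only [G.comp_inv]
  exact G.one_comp' _

theorem continuous_comp' {X : Type*} [TopologicalSpace X] {f g : X → G.Arr} (hf : Continuous f)
    (hg : Continuous g) (h : ∀ x, G.src (f x) = G.tgt (g x)) :
    Continuous fun x ↦ G.comp (f x) (g x) (h x) :=
  G.continuous_comp.comp (Continuous.subtype_mk (hf.prodMk hg) h)

end

end TopGroupoid

/-- A principal `G`-bundle over a space `B`: a continuous map `proj : Tot → B` admitting local
sections, with a right action of `G` along `moment : Tot → M`, preserving the fibres of `proj`, for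
which `(p, γ) ↦ (p, p · γ)` is a homeomorphism from `Tot ×_M Arr` (pairs with
`moment p = tgt γ`) to `Tot ×_B Tot`. -/
structure PrincipalBundle {M : Type u} [TopologicalSpace M] (G : TopGroupoid M)
    (B : Type u) [TopologicalSpace B] where
  /-- The total space. -/
  Tot : Type u
  [top : TopologicalSpace Tot]
  proj : Tot → B
  continuous_proj : Continuous proj
  hasLocalSections : HasLocalSections proj
  moment : Tot → M
  continuous_moment : Continuous moment
  act : (p : Tot) → (γ : G.Arr) → moment p = G.tgt γ → Tot
  continuous_act : Continuous fun x : {x : Tot × G.Arr // moment x.1 = G.tgt x.2} ↦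
    act x.1.1 x.1.2 x.2
  moment_act : ∀ p γ e, moment (act p γ e) = G.src γ
  act_one : ∀ p, act p (G.one (moment p)) (G.tgt_one _).symm = p
  act_act : ∀ p γ γ' (e : moment p = G.tgt γ) (e' : G.src γ = G.tgt γ'),
    act (act p γ e) γ' ((moment_act p γ e).trans e') =
      act p (G.comp γ γ' e') (e.trans (G.tgt_comp γ γ' e').symm)
  proj_act : ∀ p γ e, proj (act p γ e) = proj p
  isHomeomorph : IsHomeomorph fun x : {x : Tot × G.Arr // moment x.1 = G.tgt x.2} ↦
    (⟨(x.1.1, act x.1.1 x.1.2 x.2), (proj_act x.1.1 x.1.2 x.2).symm⟩ :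
      {y : Tot × Tot // proj y.1 = proj y.2})

namespace PrincipalBundle

attribute [instance] PrincipalBundle.top

section

variable {M : Type u} [TopologicalSpace M] {G : TopGroupoid M}
  {B : Type u} [TopologicalSpace B] (P : PrincipalBundle G B)

/-- The continuous division map: `p · div (p, p') = p'`. -/
theorem exists_div : ∃ d : {y : P.Tot × P.Tot // P.proj y.1 = P.proj y.2} → G.Arr,
    Continuous d ∧ ∀ y, ∃ e : P.moment y.1.1 = G.tgt (d y), P.act y.1.1 (d y) e = y.1.2 := by
  let E := P.isHomeomorph.homeomorph
  refine ⟨fun y ↦ (E.symm y).1.2, by fun_prop, fun y ↦ ?_⟩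
  have h : E (E.symm y) = y := E.apply_symm_apply y
  have h' := congrArg Subtype.val h
  have h1 : (E.symm y).1.1 = y.1.1 := congrArg Prod.fst h'
  have h2 : P.act (E.symm y).1.1 (E.symm y).1.2 (E.symm y).2 = y.1.2 := congrArg Prod.snd h'
  exact ⟨h1 ▸ (E.symm y).2, by rw [← h2]; simp only [h1]⟩

theorem act_free {p : P.Tot} {γ γ' : G.Arr} {e : P.moment p = G.tgt γ}
    {e' : P.moment p = G.tgt γ'} (h : P.act p γ e = P.act p γ' e') : γ = γ' := by
  have := P.isHomeomorph.injective (a₁ := ⟨(p, γ), e⟩) (a₂ := ⟨(p, γ'), e'⟩)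
    (Subtype.ext (Prod.ext rfl h))
  exact congrArg (fun x ↦ x.1.2) this

end

section Assoc

variable {M N : Type u} [TopologicalSpace M] [TopologicalSpace N]
  {G : TopGroupoid M} {H : TopGroupoid N} (φ : TopGroupoid.Hom G H)
  {B : Type u} [TopologicalSpace B] (P : PrincipalBundle G B)

/-- The fibre product `P ×_M (M ×_N H₁)` of `P` and the bibundle `M ×_N H₁ : G → H` of `φ`: a
point `(p, (m, δ))` of it has `m = moment p`, so it is a pair `(p, δ)` with
`φ (moment p) = tgt δ`. -/
abbrev AssocPre : Type u :=
  {x : P.Tot × H.Arr // φ.obj (P.moment x.1) = H.tgt x.2}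

/-- The orbit equivalence relation of the action `(p, δ) · γ = (p · γ, φ(γ)⁻¹ ∘ δ)` of `G` on the
fibre product: `(p, δ) ∼ (p', δ')` if `p' = p · γ` and `φ(γ) ∘ δ' = δ` for some arrow `γ`. -/
def assocSetoid : Setoid (AssocPre φ P) where
  r x y := ∃ (γ : G.Arr) (e : P.moment x.1.1 = G.tgt γ)
    (e' : H.src (φ.arr γ) = H.tgt y.1.2),
    y.1.1 = P.act x.1.1 γ e ∧ H.comp (φ.arr γ) y.1.2 e' = x.1.2
  iseqv := by
    constructor
    · rintro ⟨⟨p, δ⟩, h⟩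
      refine ⟨G.one (P.moment p), (G.tgt_one _).symm, ?_, (P.act_one p).symm, ?_⟩
      · simp only [φ.arr_one, H.src_one]; exact h
      · simp only [φ.arr_one]; exact H.one_comp' _
    · rintro ⟨⟨p, δ⟩, h⟩ ⟨⟨p', δ'⟩, h'⟩ ⟨γ, e, e', h1, h2⟩
      dsimp only at h h' e e' h1 h2
      subst h1 h2
      refine ⟨G.inv γ, ?_, ?_, ?_, ?_⟩
      · simp only [P.moment_act, G.tgt_inv]
      · simp only [φ.arr_inv, H.src_inv, H.tgt_comp]
      · simp only
        rw [P.act_act p γ (G.inv γ) e (G.tgt_inv γ).symm]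
        simp only [G.comp_inv, ← e, P.act_one]
      · simp only [φ.arr_inv]
        exact H.inv_comp_cancel _
    · rintro ⟨⟨p, δ⟩, h⟩ ⟨⟨p', δ'⟩, h'⟩ ⟨⟨p'', δ''⟩, h''⟩ ⟨γ, e, e', h1, h2⟩
        ⟨γ', k, k', h3, h4⟩
      dsimp only at h h' h'' e e' k k' h1 h2 h3 h4
      subst h3 h4 h1 h2
      have c : G.src γ = G.tgt γ' := by rw [← k, P.moment_act]
      refine ⟨G.comp γ γ' c, ?_, ?_, ?_, ?_⟩
      · simp only [G.tgt_comp]; exact e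
      · rw [φ.src_arr, G.src_comp, ← φ.src_arr]; exact k'
      · exact P.act_act p γ γ' e c
      · simp only [φ.arr_comp γ γ' c]
        exact H.assoc _ _ _ _ _

/-- The total space of the associated bundle: the quotient `(P ×_M (M ×_N H₁)) / G`, with the
quotient topology. -/
abbrev AssocTot : Type u := Quotient (assocSetoid φ P)

/-- The map `[p, δ] ↦ proj p`. -/
def assocProj : AssocTot φ P → B :=
  Quotient.lift (fun x ↦ P.proj x.1.1) (by
    rintro x y ⟨γ, e, e', h, -⟩
    simp only [h, P.proj_act])

/-- The map `[p, δ] ↦ src δ`. -/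
def assocMoment : AssocTot φ P → N :=
  Quotient.lift (fun x ↦ H.src x.1.2) (by
    rintro x y ⟨γ, e, e', -, h⟩
    simp only [← h, H.src_comp])

/-- The right action `[p, δ] · η = [p, δ ∘ η]` of `H`. -/
def assocAct (q : AssocTot φ P) (η : H.Arr) : assocMoment φ P q = H.tgt η → AssocTot φ P :=
  Quotient.hrecOn (motive := fun q ↦ assocMoment φ P q = H.tgt η → AssocTot φ P) q
    (fun x h ↦ ⟦⟨(x.1.1, H.comp x.1.2 η h), x.2.trans (H.tgt_comp _ _ _).symm⟩⟧) (by
      intro x y hxy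
      refine Function.hfunext (by rw [Quotient.sound hxy]) fun h h' _ ↦ heq_of_eq ?_
      obtain ⟨γ, e, e', h1, h2⟩ := hxy
      refine Quotient.sound ⟨γ, e, e'.trans (H.tgt_comp _ _ _).symm, h1, ?_⟩
      change H.src y.1.2 = H.tgt η at h'
      simp only [← h2]
      exact (H.assoc _ _ _ e' h').symm)

variable {φ P} in
theorem assocAct_mk (x : AssocPre φ P) (η : H.Arr) (h : H.src x.1.2 = H.tgt η) :
    assocAct φ P ⟦x⟧ η h =
      ⟦⟨(x.1.1, H.comp x.1.2 η h), x.2.trans (H.tgt_comp _ _ _).symm⟩⟧ := rfl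

theorem continuous_assocProj : Continuous (assocProj φ P) :=
  (P.continuous_proj.comp (continuous_fst.comp continuous_subtype_val)).quotient_lift _

theorem continuous_assocMoment : Continuous (assocMoment φ P) :=
  (H.continuous_src.comp (continuous_snd.comp continuous_subtype_val)).quotient_lift _

/-- The quotient map has local sections whose first component only depends on the base point. -/
theorem exists_assoc_section (b : B) : ∃ V : Set B, IsOpen V ∧ b ∈ V ∧
    ∃ s : assocProj φ P ⁻¹' V → AssocPre φ P, Continuous s ∧
      (∀ q, (⟦s q⟧ : AssocTot φ P) = q.1) ∧
      ∀ q q', assocProj φ P q.1 = assocProj φ P q'.1 → (s q).1.1 = (s q').1.1 := by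
  obtain ⟨V, hV, hb, σ, hσ, hσV⟩ := P.hasLocalSections b
  obtain ⟨d, hd, hdiv⟩ := P.exists_div
  let m : AssocPre φ P → AssocTot φ P := fun x ↦ ⟦x⟧
  have hm : IsQuotientMap m := isQuotientMap_quot_mk
  have hq : IsQuotientMap ((assocProj φ P ⁻¹' V).restrictPreimage m) :=
    hm.restrictPreimage_isOpen (hV.preimage (continuous_assocProj φ P))
  let D : m ⁻¹' (assocProj φ P ⁻¹' V) → G.Arr := fun x ↦
    d ⟨(σ ⟨P.proj x.1.1.1, x.2⟩, x.1.1.1), hσV _⟩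
  have hD : Continuous D := by
    refine hd.comp (Continuous.subtype_mk (Continuous.prodMk (hσ.comp ?_) ?_) _)
    · exact Continuous.subtype_mk (P.continuous_proj.comp (by fun_prop)) _
    · fun_prop
  have hD1 : ∀ x, P.moment (σ ⟨P.proj x.1.1.1, x.2⟩) = G.tgt (D x) := fun x ↦
    (hdiv ⟨(σ ⟨P.proj x.1.1.1, x.2⟩, x.1.1.1), hσV _⟩).1
  have hD2 : ∀ x, P.act _ _ (hD1 x) = x.1.1.1 := fun x ↦
    (hdiv ⟨(σ ⟨P.proj x.1.1.1, x.2⟩, x.1.1.1), hσV _⟩).2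
  have hc : ∀ x, H.src (φ.arr (D x)) = H.tgt x.1.1.2 := fun x ↦ by
    rw [φ.src_arr, ← x.1.2, ← P.moment_act _ _ (hD1 x), hD2]
  let S : m ⁻¹' (assocProj φ P ⁻¹' V) → AssocPre φ P := fun x ↦
    ⟨(σ ⟨P.proj x.1.1.1, x.2⟩, H.comp (φ.arr (D x)) x.1.1.2 (hc x)), by
      rw [H.tgt_comp, φ.tgt_arr, ← hD1]⟩
  have hS : Continuous S := by
    refine Continuous.subtype_mk (Continuous.prodMk (hσ.comp ?_) ?_) _
    · exact Continuous.subtype_mk (P.continuous_proj.comp (by fun_prop)) _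
    · exact H.continuous_comp' (φ.continuous_arr.comp hD) (by fun_prop) _
  have hmS : ∀ x, m (S x) = m x.1 := fun x ↦
    Quotient.sound ⟨D x, hD1 x, hc x, (hD2 x).symm, rfl⟩
  have hSS : ∀ x y, m x.1 = m y.1 → S x = S y := by
    intro x y hxy
    have hpr : P.proj x.1.1.1 = P.proj y.1.1.1 := congrArg (assocProj φ P) hxy
    obtain ⟨γ, e, e', h1, h2⟩ : assocSetoid φ P x.1 y.1 := Quotient.exact hxy
    have hσe : σ ⟨P.proj x.1.1.1, x.2⟩ = σ ⟨P.proj y.1.1.1, y.2⟩ := by simp only [hpr]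
    have c : G.src (D x) = G.tgt γ := by rw [← e, ← P.moment_act _ _ (hD1 x), hD2]
    have hDy : D y = G.comp (D x) γ c := by
      refine P.act_free (e := hD1 y) (e' := by rw [G.tgt_comp, ← hD1, hσe]) ?_
      refine ((hD2 y).trans h1).trans ?_
      have := P.act_act (σ ⟨P.proj x.1.1.1, x.2⟩) (D x) γ (hD1 x) c
      simp only [hD2] at this
      rw [this]
      simp only [hσe]
    refine Subtype.ext (Prod.ext hσe ?_)
    change H.comp _ _ _ = H.comp _ _ _
    simp only [hDy, φ.arr_comp (D x) γ c, ← h2]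
    exact (H.assoc _ _ _ _ _).symm
  let s : assocProj φ P ⁻¹' V → AssocPre φ P := fun q ↦
    S ⟨q.1.out, by
      change assocProj φ P ⟦q.1.out⟧ ∈ V
      rw [Quotient.out_eq]; exact q.2⟩
  have hsS : ∀ x, s ((assocProj φ P ⁻¹' V).restrictPreimage m x) = S x := fun x ↦
    hSS _ _ (Quotient.out_eq _)
  refine ⟨V, hV, hb, s, hq.continuous_iff.2 ((continuous_congr hsS).2 hS), fun q ↦ ?_,
    fun q q' h ↦ ?_⟩
  · exact (hmS _).trans (Quotient.out_eq _)
  · have key : ∀ q : assocProj φ P ⁻¹' V, (s q).1.1 = σ ⟨assocProj φ P q.1, q.2⟩ := by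
      intro q
      obtain ⟨x, rfl⟩ := hq.surjective q
      rw [hsS]; rfl
    rw [key, key]
    simp only [h]

theorem continuous_assocAct : Continuous
    fun x : {x : AssocTot φ P × H.Arr // assocMoment φ P x.1 = H.tgt x.2} ↦
      assocAct φ P x.1.1 x.1.2 x.2 := by
  rw [continuous_iff_continuousAt]
  intro x
  obtain ⟨V, hV, hb, s, hs, hs1, -⟩ := exists_assoc_section φ P (assocProj φ P x.1.1)
  let W : Set {x : AssocTot φ P × H.Arr // assocMoment φ P x.1 = H.tgt x.2} :=
    {x | assocProj φ P x.1.1 ∈ V}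
  have hW : IsOpen W := hV.preimage ((continuous_assocProj φ P).comp (by fun_prop))
  refine ContinuousOn.continuousAt (s := W) ?_ (hW.mem_nhds hb)
  rw [continuousOn_iff_continuous_domRestrict]
  have hT : Continuous fun w : W ↦ s ⟨w.1.1.1, w.2⟩ := hs.comp (by fun_prop)
  have e : ∀ w : W, H.src (s ⟨w.1.1.1, w.2⟩).1.2 = H.tgt w.1.1.2 := fun w ↦ by
    rw [← w.1.2]
    exact congrArg (assocMoment φ P) (hs1 ⟨w.1.1.1, w.2⟩)
  have : W.domRestrict (fun x ↦ assocAct φ P x.1.1 x.1.2 x.2) = fun w : W ↦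
      (⟦⟨((s ⟨w.1.1.1, w.2⟩).1.1, H.comp (s ⟨w.1.1.1, w.2⟩).1.2 w.1.1.2 (e w)),
        (s ⟨w.1.1.1, w.2⟩).2.trans (H.tgt_comp _ _ _).symm⟩⟧ : AssocTot φ P) := by
    funext w
    rw [← assocAct_mk]
    simp only [Set.domRestrict_apply, hs1]
  rw [this]
  refine continuous_quotient_mk'.comp (Continuous.subtype_mk (Continuous.prodMk (by fun_prop) ?_) _)
  exact H.continuous_comp' (by fun_prop) (by fun_prop) _

theorem assoc_hasLocalSections : HasLocalSections (assocProj φ P) := by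
  intro b
  obtain ⟨V, hV, hb, σ, hσ, hσV⟩ := P.hasLocalSections b
  refine ⟨V, hV, hb, fun v ↦ ⟦⟨(σ v, H.one (φ.obj (P.moment (σ v)))), (H.tgt_one _).symm⟩⟧, ?_, hσV⟩
  refine continuous_quotient_mk'.comp (Continuous.subtype_mk (hσ.prodMk ?_) _)
  exact H.continuous_one.comp (φ.continuous_obj.comp (P.continuous_moment.comp hσ))

theorem assocMoment_act (q : AssocTot φ P) (η : H.Arr) (e : assocMoment φ P q = H.tgt η) :
    assocMoment φ P (assocAct φ P q η e) = H.src η := by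
  induction q using Quotient.inductionOn with
  | h x => exact H.src_comp _ _ _

theorem assocProj_act (q : AssocTot φ P) (η : H.Arr) (e : assocMoment φ P q = H.tgt η) :
    assocProj φ P (assocAct φ P q η e) = assocProj φ P q := by
  induction q using Quotient.inductionOn with
  | h x => rfl

theorem assocAct_free (q : AssocTot φ P) (η η' : H.Arr) (e : assocMoment φ P q = H.tgt η)
    (e' : assocMoment φ P q = H.tgt η') (h : assocAct φ P q η e = assocAct φ P q η' e') :
    η = η' := by
  induction q using Quotient.inductionOn with
  | h x =>
    change H.src x.1.2 = _ at e e'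
    rw [assocAct_mk _ _ e, assocAct_mk _ _ e'] at h
    obtain ⟨γ, k, k', h1, h2⟩ : assocSetoid φ P _ _ := Quotient.exact h
    simp only at k k' h1 h2
    have hγ : γ = G.one (P.moment x.1.1) :=
      P.act_free (e := k) (e' := (G.tgt_one _).symm) (by rw [← h1, P.act_one])
    subst hγ
    simp only [φ.arr_one] at h2
    rw [H.one_comp'] at h2
    rw [← H.inv_comp_cancel e, ← H.inv_comp_cancel e']
    simp only [h2]

theorem assoc_isHomeomorph :
    IsHomeomorph fun x : {x : AssocTot φ P × H.Arr // assocMoment φ P x.1 = H.tgt x.2} ↦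
      (⟨(x.1.1, assocAct φ P x.1.1 x.1.2 x.2), (assocProj_act φ P x.1.1 x.1.2 x.2).symm⟩ :
        {y : AssocTot φ P × AssocTot φ P // assocProj φ P y.1 = assocProj φ P y.2}) := by
  -- a local formula for the division map
  have loc : ∀ b : B, ∃ V : Set B, IsOpen V ∧ b ∈ V ∧ ∃ d : {y : {y : AssocTot φ P × AssocTot φ P //
      assocProj φ P y.1 = assocProj φ P y.2} // assocProj φ P y.1.1 ∈ V} → H.Arr,
      Continuous d ∧ ∀ y, ∃ e, assocAct φ P y.1.1.1 (d y) e = y.1.1.2 := by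
    intro b
    obtain ⟨V, hV, hb, s, hs, hs1, hs2⟩ := exists_assoc_section φ P b
    refine ⟨V, hV, hb, ?_⟩
    let s1 : {y : {y : AssocTot φ P × AssocTot φ P //
      assocProj φ P y.1 = assocProj φ P y.2} // assocProj φ P y.1.1 ∈ V} → AssocPre φ P :=
      fun y ↦ s ⟨y.1.1.1, y.2⟩
    let s2 : {y : {y : AssocTot φ P × AssocTot φ P //
      assocProj φ P y.1 = assocProj φ P y.2} // assocProj φ P y.1.1 ∈ V} → AssocPre φ P :=
      fun y ↦ s ⟨y.1.1.2, by rw [Set.mem_preimage, ← y.1.2]; exact y.2⟩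
    have c1 : Continuous s1 := hs.comp (by fun_prop)
    have c2 : Continuous s2 := hs.comp (by fun_prop)
    have q1 : ∀ y, (⟦s1 y⟧ : AssocTot φ P) = y.1.1.1 := fun y ↦ hs1 _
    have q2 : ∀ y, (⟦s2 y⟧ : AssocTot φ P) = y.1.1.2 := fun y ↦ hs1 _
    have h12 : ∀ y, (s1 y).1.1 = (s2 y).1.1 := fun y ↦ hs2 _ _ y.1.2
    have ht : ∀ y, H.tgt (s1 y).1.2 = H.tgt (s2 y).1.2 := fun y ↦ by
      rw [← (s1 y).2, ← (s2 y).2, h12]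
    refine ⟨fun y ↦ H.comp (H.inv (s1 y).1.2) (s2 y).1.2 ((H.src_inv _).trans (ht y)),
      H.continuous_comp' (H.continuous_inv.comp (by fun_prop)) (by fun_prop) _, fun y ↦ ?_⟩
    have e : H.src (s1 y).1.2 = H.tgt (H.comp (H.inv (s1 y).1.2) (s2 y).1.2
        ((H.src_inv _).trans (ht y))) := by rw [H.tgt_comp, H.tgt_inv]
    have := assocAct_mk (s1 y) _ e
    refine ⟨by rw [← q1]; exact e, ?_⟩
    rw [← q2]
    simp only [← q1 y]
    rw [assocAct_mk _ _ e]
    refine congrArg _ (Subtype.ext (Prod.ext (h12 y) ?_))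
    exact H.comp_inv_cancel (ht y)
  have ex : ∀ y : {y : AssocTot φ P × AssocTot φ P // assocProj φ P y.1 = assocProj φ P y.2},
      ∃ η, ∃ e, assocAct φ P y.1.1 η e = y.1.2 := by
    intro y
    obtain ⟨V, -, hb, d, -, hd⟩ := loc (assocProj φ P y.1.1)
    exact ⟨d ⟨y, hb⟩, hd ⟨y, hb⟩⟩
  choose D hD1 hD2 using ex
  have cD : Continuous D := by
    rw [continuous_iff_continuousAt]
    intro y
    obtain ⟨V, hV, hb, d, cd, hd⟩ := loc (assocProj φ P y.1.1)
    let W : Set {y : AssocTot φ P × AssocTot φ P // assocProj φ P y.1 = assocProj φ P y.2} :=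
      {y | assocProj φ P y.1.1 ∈ V}
    have hW : IsOpen W := hV.preimage ((continuous_assocProj φ P).comp (by fun_prop))
    refine ContinuousOn.continuousAt (s := W) ?_ (hW.mem_nhds hb)
    rw [continuousOn_iff_continuous_domRestrict]
    refine (continuous_congr fun w ↦ ?_).2 cd
    obtain ⟨e, he⟩ := hd w
    exact assocAct_free φ P _ _ _ (hD1 _) e ((hD2 _).trans he.symm)
  rw [isHomeomorph_iff_exists_inverse]
  refine ⟨Continuous.subtype_mk (Continuous.prodMk (by fun_prop) (continuous_assocAct φ P)) _,
    fun y ↦ ⟨(y.1.1, D y), hD1 y⟩, fun x ↦ ?_, fun y ↦ ?_,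
    Continuous.subtype_mk (Continuous.prodMk (by fun_prop) cD) _⟩
  · exact Subtype.ext (Prod.ext rfl (assocAct_free φ P _ _ _ (hD1 _) x.2 (hD2 _)))
  · exact Subtype.ext (Prod.ext rfl (hD2 y))

/-- The principal `H`-bundle associated to a principal `G`-bundle `P` by a morphism
`φ : G → H`: the composite of `P` with the bibundle `M ×_N H₁ : G → H` of `φ`. -/
def assoc : PrincipalBundle H B where
  Tot := AssocTot φ P
  proj := assocProj φ P
  continuous_proj := continuous_assocProj φ P
  hasLocalSections := assoc_hasLocalSections φ P
  moment := assocMoment φ P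
  continuous_moment := continuous_assocMoment φ P
  act := assocAct φ P
  continuous_act := continuous_assocAct φ P
  moment_act := assocMoment_act φ P
  act_one q := by
    induction q using Quotient.inductionOn with
    | h x =>
      refine (assocAct_mk x _ (H.tgt_one _).symm).trans (congrArg _ (Subtype.ext (Prod.ext rfl ?_)))
      exact H.comp_one _
  act_act q η η' e e' := by
    induction q using Quotient.inductionOn with
    | h x =>
      refine congrArg (Quotient.mk (assocSetoid φ P)) (Subtype.ext (Prod.ext rfl ?_))
      exact H.assoc _ _ _ _ _
  proj_act := assocProj_act φ P
  isHomeomorph := assoc_isHomeomorph φ P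

end Assoc

end PrincipalBundle

/-- An object of `BG`: a space together with a principal `G`-bundle over it. -/
structure BundleObj {M : Type u} [TopologicalSpace M] (G : TopGroupoid M) where
  base : TopCat.{u}
  bundle : PrincipalBundle G base

namespace BundleObj

variable {M : Type u} [TopologicalSpace M] {G : TopGroupoid M}

/-- A morphism of principal bundles: a `G`-equivariant continuous map of total spaces covering a
continuous map of base spaces. -/
@[ext]
structure Hom (X Y : BundleObj G) where
  base : X.base ⟶ Y.base
  tot : X.bundle.Tot → Y.bundle.Tot
  continuous_tot : Continuous tot
  proj_tot : ∀ p, Y.bundle.proj (tot p) = base (X.bundle.proj p)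
  moment_tot : ∀ p, Y.bundle.moment (tot p) = X.bundle.moment p
  tot_act : ∀ p γ (e : X.bundle.moment p = G.tgt γ),
    tot (X.bundle.act p γ e) = Y.bundle.act (tot p) γ ((moment_tot p).trans e)

instance : Category (BundleObj G) where
  Hom := Hom
  id X :=
    { base := 𝟙 _
      tot := id
      continuous_tot := continuous_id
      proj_tot := fun _ ↦ rfl
      moment_tot := fun _ ↦ rfl
      tot_act := fun _ _ _ ↦ rfl }
  comp f g :=
    { base := f.base ≫ g.base
      tot := g.tot ∘ f.tot
      continuous_tot := g.continuous_tot.comp f.continuous_tot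
      proj_tot := fun p ↦ by simp [g.proj_tot, f.proj_tot]
      moment_tot := fun p ↦ by simp [g.moment_tot, f.moment_tot]
      tot_act := fun p γ e ↦ by simp [f.tot_act, g.tot_act] }

/-- The functor sending a principal bundle to its base space. -/
def forgetBase : BundleObj G ⥤ TopCat.{u} where
  obj X := X.base
  map f := f.base

section Assoc

variable {N : Type u} [TopologicalSpace N] {H : TopGroupoid N} (φ : TopGroupoid.Hom G H)

/-- The map `(p, δ) ↦ (f p, δ)` of fibre products induced by a morphism of bundles. -/
def assocPreMap {X Y : BundleObj G} (f : X ⟶ Y) (x : PrincipalBundle.AssocPre φ X.bundle) :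
    PrincipalBundle.AssocPre φ Y.bundle :=
  ⟨(f.tot x.1.1, x.1.2), (congrArg φ.obj (f.moment_tot x.1.1)).trans x.2⟩

/-- The morphism `[p, δ] ↦ [f p, δ]` of associated bundles induced by a morphism of bundles. -/
def assocMap {X Y : BundleObj G} (f : X ⟶ Y) :
    (⟨X.base, X.bundle.assoc φ⟩ : BundleObj H) ⟶ ⟨Y.base, Y.bundle.assoc φ⟩ where
  base := f.base
  tot := Quotient.map (assocPreMap φ f) (by
    rintro x y ⟨γ, e, e', h1, h2⟩
    exact ⟨γ, (f.moment_tot _).trans e, e', by simp only [assocPreMap, h1, f.tot_act], h2⟩)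
  continuous_tot := by
    refine Continuous.quotient_map' ?_ _
    exact Continuous.subtype_mk ((f.continuous_tot.comp (by fun_prop)).prodMk (by fun_prop)) _
  proj_tot := by rintro ⟨x⟩; exact f.proj_tot _
  moment_tot := by rintro ⟨x⟩; rfl
  tot_act := by rintro ⟨x⟩ γ e; rfl

/-- The functor sending a principal `G`-bundle to its associated `H`-bundle. -/
def assocFunctor : BundleObj G ⥤ BundleObj H where
  obj X := ⟨X.base, X.bundle.assoc φ⟩
  map f := assocMap φ f
  map_id X := by
    refine Hom.ext rfl (funext ?_)
    rintro ⟨x⟩; rfl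
  map_comp f g := by
    refine Hom.ext rfl (funext ?_)
    rintro ⟨x⟩; rfl

end Assoc

end BundleObj

namespace TopGroupoid

variable {M : Type u} [TopologicalSpace M]

/-- The category `BG` of principal `G`-bundles, as a category over the category of spaces. -/
def classifying (G : TopGroupoid M) : BasedCategory.{u, u + 1} TopCat.{u} :=
  BasedCategory.ofFunctor (BundleObj.forgetBase (G := G))

/-- The morphism `BG → BH` over the category of spaces associated to a morphism `G → H` of
topological groupoids. -/
def Hom.classifyingMap {N : Type u} [TopologicalSpace N] {G : TopGroupoid M} {H : TopGroupoid N}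
    (φ : Hom G H) : BasedFunctor G.classifying H.classifying where
  toFunctor := BundleObj.assocFunctor φ
  w := rfl

end TopGroupoid

namespace TopStack

/-! ### Categories over the category of topological spaces -/

/-- The category over `TopCat` represented by a space `U`: its objects are the continuous maps to
`U`. -/
def rep (U : TopCat.{u}) : BasedCategory.{u, u + 1} TopCat.{u} :=
  BasedCategory.ofFunctor (Over.forget U)

/-- The morphism of represented categories induced by a continuous map. -/
def repMap {U V : TopCat.{u}} (f : U ⟶ V) : BasedFunctor (rep U) (rep V) where
  toFunctor := Over.map f
  w := rfl

/-- The category over `TopCat` given by a sieve `R` on `U`: the full subcategory of the category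
represented by `U` on the maps that belong to `R`. -/
def sieveCat {U : TopCat.{u}} (R : Sieve U) : BasedCategory.{u, u + 1} TopCat.{u} :=
  BasedCategory.ofFunctor R.arrows.diagram

/-- The inclusion of a sieve on `U` into the category represented by `U`. -/
def sieveIncl {U : TopCat.{u}} (R : Sieve U) : BasedFunctor (sieveCat R) (rep U) where
  toFunctor := ObjectProperty.ι _
  w := rfl

/-- Precomposition with a morphism, as a functor between categories of morphisms over the base. -/
def precomp {𝒳 𝒴 : BasedCategory.{u, u + 1} TopCat.{u}} (F : BasedFunctor 𝒳 𝒴)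
    (𝒵 : BasedCategory.{u, u + 1} TopCat.{u}) : BasedFunctor 𝒴 𝒵 ⥤ BasedFunctor 𝒳 𝒵 where
  obj K := F.comp K
  map α := BasedCategory.whiskerLeft F α

/-- A category fibered in groupoids: a fibered category whose fibres are groupoids. In such a
category every arrow is Cartesian, so all functors over the base between categories
fibered in groupoids preserve Cartesian arrows. -/
structure IsFiberedInGroupoids (𝒟 : BasedCategory.{u, u + 1} TopCat.{u}) : Prop where
  isFibered : 𝒟.p.IsFibered
  isIso_fiber : ∀ (U : TopCat.{u}) (a b : 𝒟.p.Fiber U) (f : a ⟶ b), IsIso f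

/-- A stack (in groupoids) for the open-cover topology: a category fibered in groupoids such that
for every covering sieve `R` of `U`, restriction from the category of morphisms `U → 𝒟` (that is,
of objects of `𝒟` over `U`) to the category of morphisms `R → 𝒟` (that is, of descent data
relative to `R`) is an equivalence. -/
structure IsStack (𝒟 : BasedCategory.{u, u + 1} TopCat.{u}) : Prop where
  isFiberedInGroupoids : IsFiberedInGroupoids 𝒟
  descent : ∀ (U : TopCat.{u}) (R : Sieve U), R ∈ TopCat.grothendieckTopology U →
    (precomp (sieveIncl R) 𝒟).IsEquivalence

/-- A topological stack: a stack that is equivalent, over the category of spaces, to `BG` for some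
topological groupoid `G`. -/
structure IsTopologicalStack (𝒟 : BasedCategory.{u, u + 1} TopCat.{u}) : Prop where
  isStack : IsStack 𝒟
  exists_groupoid : ∃ (M : Type u) (_ : TopologicalSpace M) (G : TopGroupoid M)
    (E : BasedFunctor G.classifying 𝒟) (E' : BasedFunctor 𝒟 G.classifying),
    Nonempty (E.comp E' ≅ BasedFunctor.id _) ∧ Nonempty (E'.comp E ≅ BasedFunctor.id _)

/-- An epimorphism of stacks: for every morphism `q : U → 𝒞` from a space there are an open
cover `σ i : V i → U` and morphisms `qi : V i → 𝒟` such that the squares formed by `qi`, `F`,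
`σ i` and `q` commute up to a 2-isomorphism. -/
def IsEpi {𝒟 𝒞 : BasedCategory.{u, u + 1} TopCat.{u}} (F : BasedFunctor 𝒟 𝒞) : Prop :=
  ∀ (U : TopCat.{u}) (q : BasedFunctor (rep U) 𝒞),
    ∃ (ι : Type u) (V : ι → TopCat.{u}) (σ : ∀ i, V i ⟶ U),
      Presieve.ofArrows V σ ∈ TopCat.precoverage U ∧
      ∀ i, ∃ qi : BasedFunctor (rep (V i)) 𝒟, Nonempty (qi.comp F ≅ (repMap (σ i)).comp q)

section FiberProduct

variable {𝒴 𝒵 𝒳 : BasedCategory.{u, u + 1} TopCat.{u}} (f : BasedFunctor 𝒴 𝒳)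
  (g : BasedFunctor 𝒵 𝒳)

/-- An object of the 2-fibre product `𝒴 ×_𝒳 𝒵`: objects `y`, `z` over the same space and an arrow
`f y ⟶ g z` over the identity of that space. -/
structure FiberProductObj where
  fst : 𝒴.obj
  snd : 𝒵.obj
  arrow : f.obj fst ⟶ g.obj snd
  base_eq : 𝒴.p.obj fst = 𝒵.p.obj snd
  isHomLift : 𝒳.p.IsHomLift (𝟙 (𝒴.p.obj fst)) arrow

variable {f g}

/-- A morphism in the 2-fibre product: a pair of arrows over the same continuous map, compatible
with the given arrows in `𝒳`. -/
@[ext]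
structure FiberProductObj.Hom (a b : FiberProductObj f g) where
  fst : a.fst ⟶ b.fst
  snd : a.snd ⟶ b.snd
  isHomLift : 𝒵.p.IsHomLift (𝒴.p.map fst) snd
  comm : f.map fst ≫ b.arrow = a.arrow ≫ g.map snd

instance : Category (FiberProductObj f g) where
  Hom := FiberProductObj.Hom
  id a :=
    { fst := 𝟙 _
      snd := 𝟙 _
      isHomLift := by
        rw [CategoryTheory.Functor.map_id]
        exact IsHomLift.id a.base_eq.symm
      comm := by simp }
  comp {a b c} k l :=
    { fst := k.fst ≫ l.fst
      snd := k.snd ≫ l.snd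
      isHomLift := by
        have := k.isHomLift
        have := l.isHomLift
        rw [CategoryTheory.Functor.map_comp]
        infer_instance
      comm := by rw [CategoryTheory.Functor.map_comp, CategoryTheory.Functor.map_comp, Category.assoc, l.comm,
        ← Category.assoc, k.comm, Category.assoc] }
  id_comp k := FiberProductObj.Hom.ext (Category.id_comp _) (Category.id_comp _)
  comp_id k := FiberProductObj.Hom.ext (Category.comp_id _) (Category.comp_id _)
  assoc k l m := FiberProductObj.Hom.ext (Category.assoc _ _ _) (Category.assoc _ _ _)

variable (f g)

/-- The 2-fibre product `𝒴 ×_𝒳 𝒵`, as a category over the category of spaces. -/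
def fiberProduct : BasedCategory.{u, u + 1} TopCat.{u} :=
  BasedCategory.ofFunctor (𝒳 := FiberProductObj f g)
    { obj := fun a ↦ 𝒴.p.obj a.fst
      map := fun k ↦ 𝒴.p.map k.fst
      map_id := fun _ ↦ 𝒴.p.map_id _
      map_comp := fun _ _ ↦ 𝒴.p.map_comp _ _ }

end FiberProduct

/-- The diagonal `𝒟 → 𝒟 ×_𝒞 𝒟` of a morphism `F : 𝒟 → 𝒞`. -/
def diagonal {𝒟 𝒞 : BasedCategory.{u, u + 1} TopCat.{u}} (F : BasedFunctor 𝒟 𝒞) :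
    BasedFunctor 𝒟 (fiberProduct F F) where
  obj a := ⟨a, a, 𝟙 _, rfl, inferInstance⟩
  map k := ⟨k, k, inferInstance, by simp⟩
  map_id _ := rfl
  map_comp _ _ := rfl
  w := rfl

/-- A gerbe over a topological stack `𝒞`: a morphism of topological stacks `F : 𝒟 → 𝒞` such that
both `F` and its diagonal are epimorphisms of stacks. -/
structure IsGerbe {𝒟 𝒞 : BasedCategory.{u, u + 1} TopCat.{u}} (F : BasedFunctor 𝒟 𝒞) : Prop where
  source : IsTopologicalStack 𝒟
  target : IsTopologicalStack 𝒞
  isEpi : IsEpi F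
  isEpi_diagonal : IsEpi (diagonal F)

end TopStack

/-!
A continuous functor `F : G → H` that is the identity on objects and has local sections on arrows
induces a gerbe `BG → BH`. Four facts carry the proof.

* *A morphism of principal bundles is a cartesian square of spaces*
  (`BundleObj.Hom.exists_tot_eq`, `BundleObj.Hom.continuous_of_continuous_tot`): a point of the
  source is a base point together with a point of the target, continuously. Hence every arrow of
  `BG` is strongly cartesian (`BundleObj.isStronglyCartesian`), `BG` is fibered in groupoids, and
  transformations between functors to `BG` are automatically invertible.

* *`BG` is a stack* (`TopStack.isStack_classifying`). A covering sieve contains the inclusions of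
  all points, and a based functor `K` on it is controlled by its values there. A transformation
  defined on the sieve is extended point by point (`TopStack.exists_extension`), and a descent datum
  is glued to the bundle whose fibre over `b` is the value of `K` at the inclusion of `b`
  (`TopStack.Glue.bundle`); continuity is in both cases local, and is checked on small open sets
  whose inclusions belong to the sieve.

* *`BG → BH` is an epimorphism* (`TopStack.isEpi_classifyingMap`): a principal `H`-bundle with a
  section `s` is associated to the trivial principal `G`-bundle along the moment of `s`, as `G` and
  `H` have the same objects.

* *The diagonal is an epimorphism* (`TopStack.isEpi_diagonal_classifyingMap`). An object of
  `BG ×_{BH} BG` over `U` consists of two principal `G`-bundles and an isomorphism `θ` between the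
  associated `H`-bundles. In terms of local sections `s`, `s'`, the isomorphism is given by a
  continuous map `δ` to the arrows of `H` with `θ [s, 1] = [s', δ]`. As `F` has local sections, `δ`
  lifts locally to the arrows of `G`, so that `θ` is locally induced by an isomorphism of the
  `G`-bundles (`TopStack.exists_sections_of_assoc_hom`).

The last two constructions produce an isomorphism of bundles over one space only; the 2-Yoneda lemma
(`TopStack.AllCartesian.exists_natTrans`, `TopStack.AllCartesian.natTrans_ext`) turns it into an
isomorphism of functors.
-/

/-! ### Principal bundles and their morphisms -/

theorem continuous_of_locally {X Y : Type*} [TopologicalSpace X] [TopologicalSpace Y] {f : X → Y}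
    (h : ∀ x, ∃ W : Set X, IsOpen W ∧ x ∈ W ∧ Continuous fun w : W ↦ f w) : Continuous f := by
  rw [continuous_iff_continuousAt]
  intro x
  obtain ⟨W, hW, hx, hc⟩ := h x
  exact (continuousOn_iff_continuous_domRestrict.2 hc).continuousAt (hW.mem_nhds hx)

namespace PrincipalBundle

variable {M : Type u} [TopologicalSpace M] {G : TopGroupoid M}
  {B : Type u} [TopologicalSpace B] (P : PrincipalBundle G B)

theorem continuous_act' {X : Type*} [TopologicalSpace X] {f : X → P.Tot} {g : X → G.Arr}
    (hf : Continuous f) (hg : Continuous g) (h : ∀ x, P.moment (f x) = G.tgt (g x)) :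
    Continuous fun x ↦ P.act (f x) (g x) (h x) :=
  P.continuous_act.comp (Continuous.subtype_mk (hf.prodMk hg) h)

theorem exists_proj_eq (b : B) : ∃ p, P.proj p = b := by
  obtain ⟨V, -, hb, s, -, hs⟩ := P.hasLocalSections b
  exact ⟨s ⟨b, hb⟩, hs ⟨b, hb⟩⟩

theorem exists_act_eq {p p' : P.Tot} (h : P.proj p = P.proj p') :
    ∃ (γ : G.Arr) (e : P.moment p = G.tgt γ), P.act p γ e = p' := by
  obtain ⟨d, -, hd⟩ := P.exists_div
  exact ⟨_, hd ⟨(p, p'), h⟩⟩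

theorem act_eq_self {p : P.Tot} {γ : G.Arr} {e : P.moment p = G.tgt γ}
    (h : γ = G.one (P.moment p)) :
    P.act p γ e = p := by
  subst h
  exact P.act_one p

theorem act_congr {p p' : P.Tot} {γ γ' : G.Arr} (hp : p = p') (hγ : γ = γ')
    (e : P.moment p = G.tgt γ) : P.act p γ e = P.act p' γ' (by rw [← hp, ← hγ, e]) := by
  subst hp hγ
  rfl

/-- A criterion for the last axiom of a principal bundle: a free action, transitive on the fibres,
with locally continuous division maps. -/
theorem isHomeomorph_of_local_div {Tot : Type*} [TopologicalSpace Tot] {proj : Tot → B}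
    {moment : Tot → M} {act : (p : Tot) → (γ : G.Arr) → moment p = G.tgt γ → Tot}
    (hproj : Continuous proj)
    (hact : Continuous fun x : {x : Tot × G.Arr // moment x.1 = G.tgt x.2} ↦
      act x.1.1 x.1.2 x.2)
    (proj_act : ∀ p γ e, proj (act p γ e) = proj p)
    (free : ∀ p γ γ' e e', act p γ e = act p γ' e' → γ = γ')
    (loc : ∀ b : B, ∃ V : Set B, IsOpen V ∧ b ∈ V ∧
      ∃ d : {y : {y : Tot × Tot // proj y.1 = proj y.2} // proj y.1.1 ∈ V} → G.Arr,
        Continuous d ∧ ∀ y, ∃ e, act y.1.1.1 (d y) e = y.1.1.2) :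
    IsHomeomorph fun x : {x : Tot × G.Arr // moment x.1 = G.tgt x.2} ↦
      (⟨(x.1.1, act x.1.1 x.1.2 x.2), (proj_act x.1.1 x.1.2 x.2).symm⟩ :
        {y : Tot × Tot // proj y.1 = proj y.2}) := by
  have ex : ∀ y : {y : Tot × Tot // proj y.1 = proj y.2}, ∃ γ, ∃ e, act y.1.1 γ e = y.1.2 := by
    intro y
    obtain ⟨V, -, hb, d, -, hd⟩ := loc (proj y.1.1)
    exact ⟨d ⟨y, hb⟩, hd ⟨y, hb⟩⟩
  choose D hD1 hD2 using ex
  have cD : Continuous D := by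
    refine continuous_of_locally fun y ↦ ?_
    obtain ⟨V, hV, hb, d, cd, hd⟩ := loc (proj y.1.1)
    refine ⟨{y | proj y.1.1 ∈ V}, hV.preimage (hproj.comp (by fun_prop)), hb,
      (continuous_congr fun w ↦ ?_).2 cd⟩
    obtain ⟨e, he⟩ := hd w
    exact free _ _ _ (hD1 _) e ((hD2 _).trans he.symm)
  rw [isHomeomorph_iff_exists_inverse]
  refine ⟨Continuous.subtype_mk (Continuous.prodMk (by fun_prop) hact) _,
    fun y ↦ ⟨(y.1.1, D y), hD1 y⟩, fun x ↦ ?_, fun y ↦ ?_,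
    Continuous.subtype_mk (Continuous.prodMk (by fun_prop) cD) _⟩
  · exact Subtype.ext (Prod.ext rfl (free _ _ _ (hD1 _) x.2 (hD2 _)))
  · exact Subtype.ext (Prod.ext rfl (hD2 y))

section Pullback

variable {C : Type u} [TopologicalSpace C] {f : C → B}

/-- The pullback of a principal bundle along a continuous map `f` of the bases. -/
def pullback (hf : Continuous f) : PrincipalBundle G C where
  Tot := {x : C × P.Tot // P.proj x.2 = f x.1}
  proj x := x.1.1
  continuous_proj := by fun_prop
  hasLocalSections c := by
    obtain ⟨V, hV, hb, s, hs, hs'⟩ := P.hasLocalSections (f c)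
    refine ⟨f ⁻¹' V, hV.preimage hf, hb, fun v ↦ ⟨(v, s ⟨f v, v.2⟩), hs' _⟩, ?_, fun _ ↦ rfl⟩
    exact Continuous.subtype_mk (Continuous.prodMk (by fun_prop) (hs.comp
      (Continuous.subtype_mk (hf.comp continuous_subtype_val) _))) _
  moment x := P.moment x.1.2
  continuous_moment := P.continuous_moment.comp (by fun_prop)
  act x γ e := ⟨(x.1.1, P.act x.1.2 γ e), (P.proj_act _ _ _).trans x.2⟩
  continuous_act := Continuous.subtype_mk (Continuous.prodMk (by fun_prop)
    (P.continuous_act' (by fun_prop) (by fun_prop) fun x ↦ x.2)) _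
  moment_act x := P.moment_act x.1.2
  act_one x := Subtype.ext (Prod.ext rfl (P.act_one _))
  act_act x γ γ' e e' := Subtype.ext (Prod.ext rfl (P.act_act _ _ _ e e'))
  proj_act _ _ _ := rfl
  isHomeomorph := by
    obtain ⟨d, hd, hdiv⟩ := P.exists_div
    refine isHomeomorph_of_local_div (proj := fun x : {x : C × P.Tot // P.proj x.2 = f x.1} ↦ x.1.1)
      (moment := fun x ↦ P.moment x.1.2)
      (act := fun x γ e ↦ ⟨(x.1.1, P.act x.1.2 γ e), (P.proj_act _ _ _).trans x.2⟩)
      (by fun_prop) ?_ (fun _ _ _ ↦ rfl) ?_ ?_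
    · exact Continuous.subtype_mk (Continuous.prodMk (by fun_prop)
        (P.continuous_act' (by fun_prop) (by fun_prop) fun x ↦ x.2)) _
    · intro p γ γ' e e' h
      exact P.act_free (congrArg (fun x ↦ x.1.2) h)
    · intro b
      have hy : ∀ y : {y : {x : C × P.Tot // P.proj x.2 = f x.1} ×
          {x : C × P.Tot // P.proj x.2 = f x.1} // y.1.1.1 = y.2.1.1},
          P.proj y.1.1.1.2 = P.proj y.1.2.1.2 := fun y ↦ by
        rw [y.1.1.2, y.1.2.2, y.2]
      refine ⟨Set.univ, isOpen_univ, trivial, fun y ↦ d ⟨(y.1.1.1.1.2, y.1.1.2.1.2), hy y.1⟩,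
        hd.comp (by fun_prop), fun y ↦ ?_⟩
      obtain ⟨e, he⟩ := hdiv ⟨(y.1.1.1.1.2, y.1.1.2.1.2), hy y.1⟩
      exact ⟨e, Subtype.ext (Prod.ext y.1.2 he)⟩

end Pullback

variable (G) in
/-- The trivial principal `G`-bundle `B ×_M G₁` along a continuous map `m : B → M`. -/
def trivial {m : B → M} (hm : Continuous m) : PrincipalBundle G B where
  Tot := {x : B × G.Arr // m x.1 = G.tgt x.2}
  proj x := x.1.1
  continuous_proj := by fun_prop
  hasLocalSections b := by
    refine ⟨Set.univ, isOpen_univ, ⟨⟩, fun v ↦ ⟨(v, G.one (m v)), (G.tgt_one _).symm⟩, ?_,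
      fun _ ↦ rfl⟩
    exact Continuous.subtype_mk (Continuous.prodMk (by fun_prop)
      (G.continuous_one.comp (hm.comp (by fun_prop)))) _
  moment x := G.src x.1.2
  continuous_moment := G.continuous_src.comp (by fun_prop)
  act x γ e := ⟨(x.1.1, G.comp x.1.2 γ e), x.2.trans (G.tgt_comp _ _ _).symm⟩
  continuous_act := Continuous.subtype_mk (Continuous.prodMk (by fun_prop)
    (G.continuous_comp' (by fun_prop) (by fun_prop) fun x ↦ x.2)) _
  moment_act x := G.src_comp x.1.2
  act_one x := Subtype.ext (Prod.ext rfl (G.comp_one _))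
  act_act x γ γ' e e' := Subtype.ext (Prod.ext rfl (G.assoc _ _ _ e e'))
  proj_act _ _ _ := rfl
  isHomeomorph := by
    refine isHomeomorph_of_local_div (proj := fun x : {x : B × G.Arr // m x.1 = G.tgt x.2} ↦ x.1.1)
      (moment := fun x ↦ G.src x.1.2)
      (act := fun x γ e ↦ ⟨(x.1.1, G.comp x.1.2 γ e), x.2.trans (G.tgt_comp _ _ _).symm⟩)
      (by fun_prop) ?_ (fun _ _ _ ↦ rfl) ?_ ?_
    · exact Continuous.subtype_mk (Continuous.prodMk (by fun_prop)
        (G.continuous_comp' (by fun_prop) (by fun_prop) fun x ↦ x.2)) _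
    · intro p γ γ' e e' h
      have h' : G.comp p.1.2 γ e = G.comp p.1.2 γ' e' := congrArg (fun x ↦ x.1.2) h
      rw [← G.inv_comp_cancel e, ← G.inv_comp_cancel e']
      simp only [h']
    · intro b
      have hy : ∀ y : {y : {x : B × G.Arr // m x.1 = G.tgt x.2} ×
          {x : B × G.Arr // m x.1 = G.tgt x.2} // y.1.1.1 = y.2.1.1},
          G.tgt y.1.1.1.2 = G.tgt y.1.2.1.2 := fun y ↦ by
        rw [← y.1.1.2, ← y.1.2.2, y.2]
      refine ⟨Set.univ, isOpen_univ, ⟨⟩, fun y ↦ G.comp (G.inv y.1.1.1.1.2) y.1.1.2.1.2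
        ((G.src_inv _).trans (hy y.1)), G.continuous_comp' (G.continuous_inv.comp (by fun_prop))
        (by fun_prop) _, fun y ↦ ⟨?_, ?_⟩⟩
      · rw [G.tgt_comp, G.tgt_inv]
      · exact Subtype.ext (Prod.ext y.1.2 (G.comp_inv_cancel (hy y.1)))

end PrincipalBundle

namespace BundleObj

variable {M : Type u} [TopologicalSpace M] {G : TopGroupoid M}

namespace Hom

variable {X Y : BundleObj G} (f : X ⟶ Y)

/-- A point of the source of a bundle morphism is determined by its base point and its image. -/
theorem eq_of_proj_eq_of_tot_eq {x x' : X.bundle.Tot} (h : X.bundle.proj x = X.bundle.proj x')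
    (h' : f.tot x = f.tot x') : x = x' := by
  obtain ⟨γ, e, rfl⟩ := X.bundle.exists_act_eq h
  rw [f.tot_act] at h'
  refine (X.bundle.act_eq_self ?_).symm
  refine (Y.bundle.act_free (e' := (G.tgt_one _).symm)
    (h'.symm.trans (Y.bundle.act_one _).symm)).trans ?_
  rw [f.moment_tot]

/-- A morphism of principal bundles is a cartesian square of sets. -/
theorem exists_tot_eq (b : X.base) (y : Y.bundle.Tot) (h : Y.bundle.proj y = f.base b) :
    ∃ x, X.bundle.proj x = b ∧ f.tot x = y := by
  obtain ⟨p, rfl⟩ := X.bundle.exists_proj_eq b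
  obtain ⟨γ, e, rfl⟩ := Y.bundle.exists_act_eq ((f.proj_tot p).trans h.symm)
  exact ⟨X.bundle.act p γ ((f.moment_tot p).symm.trans e), X.bundle.proj_act _ _ _,
    f.tot_act _ _ _⟩

/-- A morphism of principal bundles is a cartesian square of spaces: a map to its source is
continuous as soon as its components in the base and in the target are. -/
theorem continuous_of_continuous_tot {Z : Type*} [TopologicalSpace Z] {w : Z → X.bundle.Tot}
    (h : Continuous fun z ↦ X.bundle.proj (w z)) (h' : Continuous fun z ↦ f.tot (w z)) :
    Continuous w := by
  refine continuous_of_locally fun z ↦ ?_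
  -- Over the domain of a local section `s`, `w z` is `s · d (f s, f (w z))` with `d` the division
  -- map of the target.
  obtain ⟨V, hV, hb, s, hs, hs'⟩ := X.bundle.hasLocalSections (X.bundle.proj (w z))
  obtain ⟨d, hd, hdiv⟩ := Y.bundle.exists_div
  refine ⟨_, hV.preimage h, hb, ?_⟩
  let t : (fun z ↦ X.bundle.proj (w z)) ⁻¹' V → X.bundle.Tot := fun z ↦ s ⟨X.bundle.proj (w z), z.2⟩
  have ht : Continuous t := hs.comp (Continuous.subtype_mk (h.comp continuous_subtype_val) _)
  have hpt : ∀ z, X.bundle.proj (t z) = X.bundle.proj (w z) := fun z ↦ hs' _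
  have e0 : ∀ z, Y.bundle.proj (f.tot (t z)) = Y.bundle.proj (f.tot (w z)) := fun z ↦ by
    rw [f.proj_tot, f.proj_tot, hpt]
  have e1 : ∀ z, X.bundle.moment (t z) = G.tgt (d ⟨(f.tot (t z), f.tot (w z)), e0 z⟩) := fun z ↦
    (f.moment_tot _).symm.trans (hdiv ⟨(f.tot (t z), f.tot (w z)), e0 z⟩).1
  refine (continuous_congr fun z ↦ ?_).2 (X.bundle.continuous_act' ht
    (hd.comp (Continuous.subtype_mk ((f.continuous_tot.comp ht).prodMk
      (h'.comp continuous_subtype_val)) e0)) e1)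
  refine f.eq_of_proj_eq_of_tot_eq ?_ ?_
  · rw [X.bundle.proj_act, hpt]
  · rw [f.tot_act]
    exact (hdiv ⟨(f.tot (t z), f.tot (w z)), e0 z⟩).2.symm

theorem exists_lift {Z : Type*} [TopologicalSpace Z] {a : Z → X.base} {y : Z → Y.bundle.Tot}
    (ha : Continuous a) (hy : Continuous y) (h : ∀ z, Y.bundle.proj (y z) = f.base (a z)) :
    ∃ w : Z → X.bundle.Tot, Continuous w ∧ (∀ z, X.bundle.proj (w z) = a z) ∧
      ∀ z, f.tot (w z) = y z := by
  choose w hw1 hw2 using fun z ↦ f.exists_tot_eq (a z) (y z) (h z)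
  exact ⟨w, f.continuous_of_continuous_tot ((continuous_congr hw1).2 ha)
    ((continuous_congr hw2).2 hy), hw1, hw2⟩

/-- Two morphisms of bundles with the same base map agree if they agree at one point of each
fibre. -/
theorem ext_of_section {f g : X ⟶ Y} (hb : f.base = g.base) {s : X.base → X.bundle.Tot}
    (hs : ∀ b, X.bundle.proj (s b) = b) (h : ∀ b, f.tot (s b) = g.tot (s b)) : f = g := by
  refine Hom.ext hb (funext fun p ↦ ?_)
  obtain ⟨γ, e, he⟩ := X.bundle.exists_act_eq (hs (X.bundle.proj p))
  rw [← he, f.tot_act, g.tot_act]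
  exact Y.bundle.act_congr (h _) rfl _

/-- If the source has a global section `s`, there is a bundle morphism with prescribed values
on `s`, namely `s · γ ↦ t · γ`. -/
theorem exists_of_section (φ : X.base ⟶ Y.base) {s : X.base → X.bundle.Tot} (hs : Continuous s)
    (hs' : ∀ b, X.bundle.proj (s b) = b) {t : X.base → Y.bundle.Tot} (ht : Continuous t)
    (ht' : ∀ b, Y.bundle.proj (t b) = φ b)
    (hm : ∀ b, Y.bundle.moment (t b) = X.bundle.moment (s b)) :
    ∃ f : X ⟶ Y, f.base = φ ∧ ∀ b, f.tot (s b) = t b := by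
  obtain ⟨d, hd, hdiv⟩ := X.bundle.exists_div
  let D : X.bundle.Tot → G.Arr := fun x ↦ d ⟨(s (X.bundle.proj x), x), hs' _⟩
  have hD : Continuous D := hd.comp (Continuous.subtype_mk
    ((hs.comp X.bundle.continuous_proj).prodMk continuous_id) _)
  have hD1 : ∀ x, X.bundle.moment (s (X.bundle.proj x)) = G.tgt (D x) := fun x ↦
    (hdiv ⟨(s (X.bundle.proj x), x), hs' _⟩).1
  have hD2 : ∀ x, X.bundle.act _ (D x) (hD1 x) = x := fun x ↦
    (hdiv ⟨(s (X.bundle.proj x), x), hs' _⟩).2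
  have key : ∀ b γ (e : X.bundle.moment (s b) = G.tgt γ), D (X.bundle.act (s b) γ e) = γ := by
    intro b γ e
    refine X.bundle.act_free (e := ?_) (e' := e) ?_ (p := s b)
    · rw [← hD1, X.bundle.proj_act, hs']
    · refine Eq.trans ?_ (hD2 _)
      exact X.bundle.act_congr (by rw [X.bundle.proj_act, hs']) rfl _
  refine ⟨{
    base := φ
    tot x := Y.bundle.act (t (X.bundle.proj x)) (D x) ((hm _).trans (hD1 x))
    continuous_tot := Y.bundle.continuous_act' (ht.comp X.bundle.continuous_proj) hD _
    proj_tot x := by rw [Y.bundle.proj_act, ht']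
    moment_tot x := by rw [Y.bundle.moment_act, ← X.bundle.moment_act _ (D x) (hD1 x), hD2]
    tot_act x γ e := ?_ }, rfl, fun b ↦ ?_⟩
  · have c : G.src (D x) = G.tgt γ := by rw [← e, ← X.bundle.moment_act _ (D x) (hD1 x), hD2]
    refine (Y.bundle.act_congr (γ' := G.comp (D x) γ c) (by rw [X.bundle.proj_act]) ?_ _).trans
      (Y.bundle.act_act _ _ _ _ c).symm
    rw [← key (X.bundle.proj x) (G.comp (D x) γ c) ((hD1 x).trans (G.tgt_comp _ _ _).symm)]
    congr 1
    rw [← X.bundle.act_act _ _ _ (hD1 x) c]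
    exact X.bundle.act_congr (hD2 x).symm rfl _
  · refine (Y.bundle.act_congr (by rw [hs']) rfl _).trans (Y.bundle.act_eq_self ?_)
    rw [hm, ← key b (G.one (X.bundle.moment (s b))) (G.tgt_one _).symm, X.bundle.act_one]

end Hom

/-- The equivariant maps from a principal `G`-bundle to a principal `H`-bundle along `φ : G → H`
factor through the associated bundle, as `[p, δ] ↦ t p · δ`. -/
theorem exists_assoc_desc {N : Type u} [TopologicalSpace N] {H : TopGroupoid N}
    (φ : TopGroupoid.Hom G H) (X : BundleObj G) (Y : BundleObj H) (g : X.base ⟶ Y.base)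
    {t : X.bundle.Tot → Y.bundle.Tot} (ht : Continuous t)
    (ht' : ∀ x, Y.bundle.proj (t x) = g (X.bundle.proj x))
    (hm : ∀ x, Y.bundle.moment (t x) = φ.obj (X.bundle.moment x))
    (ha : ∀ x γ (e : X.bundle.moment x = G.tgt γ), t (X.bundle.act x γ e) =
      Y.bundle.act (t x) (φ.arr γ) (by rw [hm, φ.tgt_arr, e])) :
    ∃ f : (⟨X.base, X.bundle.assoc φ⟩ : BundleObj H) ⟶ Y, f.base = g := by
  refine ⟨{
    base := g
    tot := Quotient.lift (fun x : PrincipalBundle.AssocPre φ X.bundle ↦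
      Y.bundle.act (t x.1.1) x.1.2 ((hm _).trans x.2)) ?_
    continuous_tot := ?_
    proj_tot := ?_
    moment_tot := ?_
    tot_act := ?_ }, rfl⟩
  · rintro ⟨⟨p, δ⟩, h⟩ ⟨⟨p', δ'⟩, h'⟩ ⟨γ, e, e', h1, h2⟩
    dsimp only at h h' e e' h1 h2 ⊢
    subst h1 h2
    refine (Y.bundle.act_act _ _ _ (by rw [hm, φ.tgt_arr, e]) e').symm.trans ?_
    exact Y.bundle.act_congr (ha _ _ _).symm rfl _
  · exact (Y.bundle.continuous_act' (ht.comp (by fun_prop)) (by fun_prop) _).quotient_lift _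
  · rintro ⟨x⟩
    exact (Y.bundle.proj_act _ _ _).trans (ht' _)
  · rintro ⟨x⟩
    exact Y.bundle.moment_act _ _ _
  · rintro ⟨x⟩ γ e
    exact (Y.bundle.act_act _ _ _ _ _).symm

end BundleObj
/-! ### Cartesian arrows and functors to the category of principal bundles -/

namespace PrincipalBundle

variable {M : Type u} [TopologicalSpace M] {G : TopGroupoid M}

/-- Transport of a principal bundle along an equality of base spaces. Only the projection changes,
so that the total space, the moment map and the action are the same by definition. -/
def castBase {S T : TopCat.{u}} (h : S = T) (P : PrincipalBundle G S) : PrincipalBundle G T where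
  Tot := P.Tot
  proj p := eqToHom h (P.proj p)
  continuous_proj := (eqToHom h).hom.continuous.comp P.continuous_proj
  hasLocalSections := by subst h; exact P.hasLocalSections
  moment := P.moment
  continuous_moment := P.continuous_moment
  act := P.act
  continuous_act := P.continuous_act
  moment_act := P.moment_act
  act_one := P.act_one
  act_act := P.act_act
  proj_act p γ e := by rw [P.proj_act]
  isHomeomorph := by subst h; exact P.isHomeomorph

end PrincipalBundle

namespace BundleObj

variable {M : Type u} [TopologicalSpace M] {G : TopGroupoid M}

theorem base_eq_of_isHomLift {X Y : BundleObj G} {g : X.base ⟶ Y.base} {f : X ⟶ Y}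
    (h : (forgetBase (G := G)).IsHomLift g f) : f.base = g :=
  (@IsHomLift.eq_of_isHomLift _ _ _ _ (forgetBase (G := G)) X Y g f h).symm

theorem isHomLift_of_base_eq {X Y : BundleObj G} {g : X.base ⟶ Y.base} {f : X ⟶ Y}
    (h : f.base = g) : (forgetBase (G := G)).IsHomLift g f := by
  subst h
  exact IsHomLift.map (forgetBase (G := G)) f

/-- Transport of an object of `BG` along an equality of base spaces. -/
abbrev cast (X : BundleObj G) {S : TopCat.{u}} (h : X.base = S) : BundleObj G :=
  ⟨S, X.bundle.castBase h⟩

/-- A bundle morphism lifting `g`, as a morphism of transported bundles whose base map is `g` by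
definition. -/
def castHom {X Y : BundleObj G} {S T : TopCat.{u}} (hX : X.base = S) (hY : Y.base = T) (g : S ⟶ T)
    (f : X ⟶ Y) (hf : (forgetBase (G := G)).IsHomLift g f) : X.cast hX ⟶ Y.cast hY where
  base := g
  tot := f.tot
  continuous_tot := f.continuous_tot
  proj_tot p := by
    subst hX hY
    have := base_eq_of_isHomLift hf
    subst this
    exact f.proj_tot p
  moment_tot := f.moment_tot
  tot_act := f.tot_act

/-- The inverse of `castHom`: the base map is conjugated with the equalities of base spaces. -/
def uncastHom {X Y : BundleObj G} {S T : TopCat.{u}} (hX : X.base = S) (hY : Y.base = T)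
    (f : X.cast hX ⟶ Y.cast hY) : X ⟶ Y where
  base := eqToHom hX ≫ f.base ≫ eqToHom hY.symm
  tot := f.tot
  continuous_tot := f.continuous_tot
  proj_tot p := by
    subst hX hY
    exact f.proj_tot p
  moment_tot := f.moment_tot
  tot_act := f.tot_act

theorem isHomLift_uncastHom {X Y : BundleObj G} {S T : TopCat.{u}} (hX : X.base = S)
    (hY : Y.base = T) (f : X.cast hX ⟶ Y.cast hY) :
    (forgetBase (G := G)).IsHomLift f.base (uncastHom hX hY f) := by
  subst hX hY
  refine isHomLift_of_base_eq ?_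
  simp [uncastHom]

/-- A morphism of bundles lifting a given map is determined by its map of total spaces. -/
theorem hom_ext_of_isHomLift {X Y : BundleObj G} {S T : TopCat.{u}} (g : S ⟶ T) {f f' : X ⟶ Y}
    (hf : (forgetBase (G := G)).IsHomLift g f) (hf' : (forgetBase (G := G)).IsHomLift g f')
    (h : f.tot = f'.tot) : f = f' := by
  refine Hom.ext ?_ h
  have e := IsHomLift.fac' (forgetBase (G := G)) g f
  have e' := IsHomLift.fac' (forgetBase (G := G)) g f'
  exact e.trans e'.symm

/-- Every morphism of principal bundles is strongly cartesian over the category of spaces. -/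
instance isStronglyCartesian {X Y : BundleObj G} (f : X ⟶ Y) :
    (forgetBase (G := G)).IsStronglyCartesian ((forgetBase (G := G)).map f) f where
  universal_property' {Z} g φ hφ := by
    have hb : φ.base = g ≫ f.base := base_eq_of_isHomLift hφ
    obtain ⟨w, hw, hw1, hw2⟩ := f.exists_lift (a := fun z ↦ g (Z.bundle.proj z)) (y := φ.tot)
      (g.hom.continuous.comp Z.bundle.continuous_proj) φ.continuous_tot fun z ↦ by
        rw [φ.proj_tot, hb]; rfl
    refine ⟨{
      base := g
      tot := w
      continuous_tot := hw
      proj_tot := hw1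
      moment_tot := fun z ↦ by rw [← f.moment_tot, hw2, φ.moment_tot]
      tot_act := fun z γ e ↦ ?_ }, ⟨isHomLift_of_base_eq rfl, Hom.ext hb.symm (funext hw2)⟩, ?_⟩
    · refine f.eq_of_proj_eq_of_tot_eq ?_ ?_
      · rw [hw1, X.bundle.proj_act, hw1, Z.bundle.proj_act]
      · rw [hw2, f.tot_act, φ.tot_act]
        exact Y.bundle.act_congr (hw2 z).symm rfl _
    · rintro χ ⟨hχ, rfl⟩
      have hχ' : χ.base = g := base_eq_of_isHomLift hχ
      refine Hom.ext hχ' (funext fun z ↦ f.eq_of_proj_eq_of_tot_eq ?_ ?_)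
      · rw [χ.proj_tot, hχ']
        exact (hw1 z).symm
      · exact (hw2 z).symm

end BundleObj

namespace TopStack

/-- All arrows of a based category are strongly cartesian. This holds in every category fibered in
groupoids. -/
abbrev AllCartesian (𝒟 : BasedCategory.{u, u + 1} TopCat.{u}) : Prop :=
  ∀ ⦃a b : 𝒟.obj⦄ (f : a ⟶ b), 𝒟.p.IsStronglyCartesian (𝒟.p.map f) f

section AllCartesian

variable {𝒟 : BasedCategory.{u, u + 1} TopCat.{u}}

theorem AllCartesian.isStronglyCartesian (h𝒟 : AllCartesian 𝒟) {S T : TopCat.{u}} (g : S ⟶ T)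
    {a b : 𝒟.obj} (f : a ⟶ b) [𝒟.p.IsHomLift g f] : 𝒟.p.IsStronglyCartesian g f := by
  subst_hom_lift 𝒟.p g f
  exact h𝒟 f

theorem AllCartesian.isIso (h𝒟 : AllCartesian 𝒟) {S T : TopCat.{u}} (g : S ⟶ T) [IsIso g]
    {a b : 𝒟.obj} (f : a ⟶ b) [𝒟.p.IsHomLift g f] : IsIso f :=
  have := h𝒟.isStronglyCartesian g f
  Functor.IsStronglyCartesian.isIso_of_base_isIso 𝒟.p g f

theorem AllCartesian.isIso_app (h𝒟 : AllCartesian 𝒟) {𝒳 : BasedCategory.{u, u + 1} TopCat.{u}}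
    {K L : BasedFunctor 𝒳 𝒟} (α : K ⟶ L) (a : 𝒳.obj) : IsIso (α.toNatTrans.app a) :=
  have := α.isHomLift' a
  h𝒟.isIso (𝟙 (𝒳.p.obj a)) _

/-- A transformation of functors over the base is invertible as soon as all arrows of the target
are cartesian. -/
theorem AllCartesian.isIso_natTrans (h𝒟 : AllCartesian 𝒟)
    {𝒳 : BasedCategory.{u, u + 1} TopCat.{u}} {K L : BasedFunctor 𝒳 𝒟} (α : K ⟶ L) : IsIso α := by
  have := h𝒟.isIso_app α
  have : IsIso (X := K.toFunctor) α.toNatTrans := NatIso.isIso_of_isIso_app _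
  exact BasedNatIso.isIso_of_toNatTrans_isIso α

/-- The object of the category represented by `U` given by a map to `U`. -/
abbrev repMk {U T : TopCat.{u}} (f : T ⟶ U) : (rep U).obj :=
  Over.mk f

/-- The structure map to `U` of an object of the category represented by `U`. -/
abbrev repHom {U : TopCat.{u}} (T : (rep U).obj) : (rep U).p.obj T ⟶ U :=
  Over.hom T

/-- The arrow from `T` to the terminal object of the category represented by `U`. -/
def toTerminal {U : TopCat.{u}} (T : (rep U).obj) : T ⟶ repMk (𝟙 U) :=
  Over.homMk (repHom T)

instance {U : TopCat.{u}} (T : (rep U).obj) : (rep U).p.IsHomLift (repHom T) (toTerminal T) :=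
  IsHomLift.map (rep U).p (toTerminal T)

theorem comp_toTerminal {U : TopCat.{u}} {T T' : (rep U).obj} (g : T ⟶ T') :
    g ≫ toTerminal T' = toTerminal T :=
  Over.OverMorphism.ext (Over.w g)

theorem toTerminal_repMk_id (U : TopCat.{u}) : toTerminal (repMk (𝟙 U)) = 𝟙 _ := rfl

/-- Uniqueness in the 2-Yoneda lemma. -/
theorem AllCartesian.natTrans_ext (h𝒟 : AllCartesian 𝒟) {U : TopCat.{u}}
    {K L : BasedFunctor (rep U) 𝒟} {α β : K ⟶ L}
    (h : α.toNatTrans.app (repMk (𝟙 U)) = β.toNatTrans.app (repMk (𝟙 U))) : α = β := by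
  refine BasedNatTrans.homCategory.ext _ _ (NatTrans.ext (funext fun T ↦ ?_))
  have hα := α.isHomLift' T
  have hβ := β.isHomLift' T
  have hL := h𝒟.isStronglyCartesian (repHom T) (L.map (toTerminal T))
  refine Functor.IsStronglyCartesian.ext 𝒟.p (repHom T) (L.map (toTerminal T))
    (𝟙 ((rep U).p.obj T)) ?_
  have n1 := α.toNatTrans.naturality (toTerminal T)
  have n2 := β.toNatTrans.naturality (toTerminal T)
  exact n1.symm.trans ((congrArg _ h).trans n2)

/-- Existence in the 2-Yoneda lemma. -/
theorem AllCartesian.exists_natTrans (h𝒟 : AllCartesian 𝒟) {U : TopCat.{u}}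
    {K L : BasedFunctor (rep U) 𝒟} (f : K.obj (repMk (𝟙 U)) ⟶ L.obj (repMk (𝟙 U)))
    (hf : 𝒟.p.IsHomLift (𝟙 U) f) :
    ∃ α : K ⟶ L, α.toNatTrans.app (repMk (𝟙 U)) = f := by
  have hL : ∀ T, 𝒟.p.IsStronglyCartesian (repHom T) (L.map (toTerminal T)) := fun T ↦
    h𝒟.isStronglyCartesian (repHom T) _
  let A (T : (rep U).obj) : K.obj T ⟶ L.obj T := Functor.IsStronglyCartesian.map 𝒟.p (repHom T)
    (L.map (toTerminal T)) (Category.id_comp (repHom T)).symm (K.map (toTerminal T) ≫ f)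
  have hA : ∀ T, 𝒟.p.IsHomLift (𝟙 ((rep U).p.obj T)) (A T) := fun T ↦
    Functor.IsStronglyCartesian.map_isHomLift _ _ _ _ _
  have hA' : ∀ T, A T ≫ L.map (toTerminal T) = K.map (toTerminal T) ≫ f := fun T ↦
    Functor.IsStronglyCartesian.fac _ _ _ _ _
  refine ⟨{ app := A, naturality := fun T T' g ↦ ?_, isHomLift' := hA }, ?_⟩
  · have h1 : 𝒟.p.IsHomLift ((rep U).p.map g) (K.map g ≫ A T') := inferInstance
    have h2 : 𝒟.p.IsHomLift ((rep U).p.map g) (A T ≫ L.map g) := inferInstance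
    refine Functor.IsStronglyCartesian.ext 𝒟.p (repHom T') (L.map (toTerminal T'))
      ((rep U).p.map g) ?_
    rw [Category.assoc, Category.assoc, hA', ← Category.assoc, ← Functor.map_comp,
      ← Functor.map_comp, comp_toTerminal, hA']
  · have := hA' (repMk (𝟙 U))
    rw [toTerminal_repMk_id, CategoryTheory.Functor.map_id, CategoryTheory.Functor.map_id,
      Category.comp_id, Category.id_comp] at this
    exact this

end AllCartesian

end TopStack

namespace TopGroupoid

variable {M : Type u} [TopologicalSpace M] (G : TopGroupoid M)

theorem allCartesian_classifying : TopStack.AllCartesian G.classifying :=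
  fun _ _ f ↦ BundleObj.isStronglyCartesian f

theorem isFiberedInGroupoids_classifying : TopStack.IsFiberedInGroupoids G.classifying where
  isFibered := by
    refine Functor.IsFibered.of_exists_isStronglyCartesian fun (X : BundleObj G) R f ↦ ?_
    let φ : (⟨R, X.bundle.pullback (f := f) f.hom.continuous⟩ : BundleObj G) ⟶ X :=
      { base := f
        tot := fun x ↦ x.1.2
        continuous_tot := continuous_snd.comp continuous_subtype_val
        proj_tot := fun x ↦ x.2
        moment_tot := fun _ ↦ rfl
        tot_act := fun _ _ _ ↦ rfl }
    exact ⟨_, φ, BundleObj.isStronglyCartesian φ⟩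
  isIso_fiber U a b f := by
    have := f.2
    have : IsIso f.1 := G.allCartesian_classifying.isIso (𝟙 U) f.1
    have h : G.classifying.p.IsHomLift (𝟙 U) (CategoryTheory.inv f.1) := inferInstance
    exact ⟨⟨CategoryTheory.inv f.1, h⟩, Subtype.ext (IsIso.hom_inv_id f.1),
      Subtype.ext (IsIso.inv_hom_id f.1)⟩

end TopGroupoid

namespace TopStack

variable {M : Type u} [TopologicalSpace M] {G : TopGroupoid M}

section Strict

variable {𝒳 : BasedCategory.{u, u + 1} TopCat.{u}} (K L : BasedFunctor 𝒳 G.classifying)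

/-- The principal bundle `K a` over `p a`, for a functor `K : 𝒳 → BG` over the category of spaces.
The base of `K a` is only propositionally equal to `p a`, and this is the transported object. -/
abbrev bundleAt (a : 𝒳.obj) : BundleObj G :=
  BundleObj.cast (K.obj a) (K.w_obj a)

/-- The bundle morphism `K f`, with base map `p f`. -/
def bundleMap {a b : 𝒳.obj} (f : a ⟶ b) : bundleAt K a ⟶ bundleAt K b :=
  BundleObj.castHom (K.w_obj a) (K.w_obj b) (𝒳.p.map f) (K.map f)
    (inferInstanceAs (G.classifying.p.IsHomLift (𝒳.p.map f) (K.map f)))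

theorem bundleMap_base {a b : 𝒳.obj} (f : a ⟶ b) : (bundleMap K f).base = 𝒳.p.map f := rfl

theorem bundleMap_comp_tot {a b c : 𝒳.obj} (f : a ⟶ b) (g : b ⟶ c) (x) :
    (bundleMap K (f ≫ g)).tot x = (bundleMap K g).tot ((bundleMap K f).tot x) := by
  have : K.map (f ≫ g) = K.map f ≫ K.map g := K.map_comp f g
  exact congrFun (congrArg (BundleObj.Hom.tot (G := G)) this) x

variable {K L}

/-- The component of a transformation at `a`, with base map the identity. -/
def bundleApp (α : K ⟶ L) (a : 𝒳.obj) : bundleAt K a ⟶ bundleAt L a :=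
  BundleObj.castHom (K.w_obj a) (L.w_obj a) (𝟙 _) (α.toNatTrans.app a) (α.isHomLift' a)

theorem bundleApp_naturality (α : K ⟶ L) {a b : 𝒳.obj} (f : a ⟶ b) (x) :
    (bundleApp α b).tot ((bundleMap K f).tot x) = (bundleMap L f).tot ((bundleApp α a).tot x) :=
  congrFun (congrArg (BundleObj.Hom.tot (G := G)) (α.toNatTrans.naturality f)) x

/-- A transformation of functors to `BG` from its components. -/
def natTransMk (η : ∀ a, bundleAt K a ⟶ bundleAt L a) (hη : ∀ a, (η a).base = 𝟙 _)
    (nat : ∀ {a b : 𝒳.obj} (f : a ⟶ b) (x),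
      (η b).tot ((bundleMap K f).tot x) = (bundleMap L f).tot ((η a).tot x)) : K ⟶ L where
  app a := BundleObj.uncastHom (K.w_obj a) (L.w_obj a) (η a)
  isHomLift' a := by
    rw [← hη a]
    exact BundleObj.isHomLift_uncastHom _ _ _
  naturality a b f := by
    have h : ∀ a, G.classifying.p.IsHomLift (𝟙 (𝒳.p.obj a))
        (BundleObj.uncastHom (K.w_obj a) (L.w_obj a) (η a)) := fun a ↦ by
      rw [← hη a]
      exact BundleObj.isHomLift_uncastHom _ _ _
    have ha := h a
    have hb := h b
    refine BundleObj.hom_ext_of_isHomLift (𝒳.p.map f) ?_ ?_ (funext fun x ↦ nat f x)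
    · exact IsHomLift.comp_lift_id_right G.classifying.p (𝒳.p.map f) (K.map f) _
    · exact IsHomLift.comp_lift_id_left G.classifying.p (𝒳.p.map f) (L.map f) _

theorem natTrans_ext_tot {α β : K ⟶ L}
    (h : ∀ a x, (bundleApp α a).tot x = (bundleApp β a).tot x) : α = β :=
  BasedNatTrans.homCategory.ext _ _ (NatTrans.ext (funext fun a ↦
    BundleObj.hom_ext_of_isHomLift (𝟙 (𝒳.p.obj a)) (α.isHomLift' a) (β.isHomLift' a)
      (funext fun x ↦ h a x)))

end Strict

/-- The morphism `U → BG` given by a principal bundle over `U`: it sends a map to `U` to the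
pullback of the bundle. -/
def ofBundle {U : TopCat.{u}} (P : PrincipalBundle G U) : BasedFunctor (rep U) G.classifying where
  obj T := (⟨T.left, P.pullback (f := T.hom) T.hom.hom.continuous⟩ : BundleObj G)
  map {S _} f :=
    { base := Over.Hom.left f
      tot := fun x ↦ ⟨(Over.Hom.left f x.1.1, x.1.2), x.2.trans
        (congrArg (fun g : (rep U).p.obj S ⟶ U ↦ g x.1.1) (Over.w f).symm)⟩
      continuous_tot := Continuous.subtype_mk (Continuous.prodMk
        ((Over.Hom.left f).hom.continuous.comp (continuous_fst.comp continuous_subtype_val))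
        (continuous_snd.comp continuous_subtype_val)) _
      proj_tot := fun _ ↦ rfl
      moment_tot := fun _ ↦ rfl
      tot_act := fun _ _ _ ↦ rfl }
  map_id _ := BundleObj.Hom.ext rfl (funext fun _ ↦ rfl)
  map_comp _ _ := BundleObj.Hom.ext rfl (funext fun _ ↦ rfl)
  w := rfl

end TopStack
/-! ### Covering sieves of spaces -/

namespace TopStack

/-- The inclusion of a subset of a space, as a morphism of spaces. -/
abbrev openIncl {U : TopCat.{u}} (V : Set U) : TopCat.of V ⟶ U :=
  TopCat.ofHom ⟨Subtype.val, continuous_subtype_val⟩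

/-- The inclusion of a point of a space, as a morphism of spaces. -/
abbrev pointIncl {U : TopCat.{u}} (b : U) : TopCat.of PUnit.{u + 1} ⟶ U :=
  TopCat.ofHom (ContinuousMap.const _ b)

theorem sieve_of_range_subset {U : TopCat.{u}} {R : Sieve U} {V : Set U} (hV : R (openIncl V))
    {T : TopCat.{u}} (f : T ⟶ U) (hf : ∀ t, f t ∈ V) : R f := by
  have := R.downward_closed hV (TopCat.ofHom ⟨fun t : T ↦ (⟨f t, hf t⟩ : V),
    Continuous.subtype_mk f.hom.continuous _⟩)
  exact this

/-- A covering sieve contains the inclusion of an open neighbourhood of each point. -/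
theorem exists_openIncl_mem {U : TopCat.{u}} {R : Sieve U} (hR : R ∈ TopCat.grothendieckTopology U)
    (b : U) : ∃ V : Set U, IsOpen V ∧ b ∈ V ∧ R (openIncl V) := by
  have hR' : TopCat.precoverage.Saturate U R := hR
  induction hR' with
  | of U S hS =>
    obtain ⟨Y, f, hf, y, rfl⟩ : ∃ (Y : TopCat.{u}) (f : Y ⟶ U), S f ∧ ∃ y, f y = b := by
      obtain ⟨Y, f, hf, h⟩ :=
        (Presieve.mem_comap_jointlySurjectivePrecoverage_iff _).1 hS.1 b
      exact ⟨Y, f, hf, h⟩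
    have hf' : IsOpenEmbedding f := hS.2 hf
    refine ⟨Set.range f, hf'.isOpen_range, ⟨y, rfl⟩, ?_⟩
    refine ⟨Y, TopCat.ofHom ⟨hf'.toIsEmbedding.toHomeomorph.symm, by fun_prop⟩, f, hf, ?_⟩
    ext v
    exact congrArg Subtype.val (hf'.toIsEmbedding.toHomeomorph.apply_symm_apply v)
  | top U => exact ⟨Set.univ, isOpen_univ, trivial, trivial⟩
  | pullback U S hS Y f ih =>
    obtain ⟨V, hV, hb, h⟩ := ih hS (f b)
    exact ⟨f ⁻¹' V, hV.preimage f.hom.continuous, hb, sieve_of_range_subset h _ fun t ↦ t.2⟩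
  | transitive U S R hS hSR ih ih' =>
    obtain ⟨V, hV, hb, h⟩ := ih hS b
    obtain ⟨W, hW, hb', h'⟩ := ih' h (hSR h) ⟨b, hb⟩
    refine ⟨Subtype.val '' W, hV.isOpenMap_subtype_val W hW, ⟨_, hb', rfl⟩, ?_⟩
    have hin : ∀ v : (Subtype.val '' W : Set U), ∃ h : v.1 ∈ V, (⟨v.1, h⟩ : V) ∈ W := by
      rintro ⟨_, w, hw, rfl⟩
      exact ⟨w.2, hw⟩
    exact R.downward_closed h' (TopCat.ofHom ⟨fun t : (Subtype.val '' W : Set U) ↦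
      (⟨⟨t.1, (hin t).1⟩, (hin t).2⟩ : W), by fun_prop⟩)

theorem ofArrows_openIncl_mem_precoverage {U : TopCat.{u}} {ι : Type u} {V : ι → Set U}
    (hV : ∀ i, IsOpen (V i)) (hc : ∀ b, ∃ i, b ∈ V i) :
    Presieve.ofArrows (fun i ↦ TopCat.of (V i)) (fun i ↦ openIncl (V i)) ∈
      TopCat.precoverage U := by
  refine ⟨?_, ?_⟩
  · simp only [Precoverage.mem_comap_iff, Presieve.map_ofArrows,
      Types.ofArrows_mem_jointlySurjectivePrecoverage_iff]
    intro b
    obtain ⟨i, hi⟩ := hc b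
    exact ⟨i, ⟨b, hi⟩, rfl⟩
  · simp only [MorphismProperty.ofArrows_mem_precoverage, TopCat.isOpenEmbedding_iff]
    exact fun i ↦ (hV i).isOpenEmbedding_subtypeVal

section Objects

variable {U : TopCat.{u}} {R : Sieve U}

/-- The arrow of the category represented by `U` given by a continuous map over `U`. -/
def repHomMk {S T : (rep U).obj} (g : (rep U).p.obj S ⟶ (rep U).p.obj T)
    (h : ∀ s, repHom T (g s) = repHom S s) : S ⟶ T :=
  Over.homMk g (by ext s; exact h s)

theorem rep_hom_ext {S T : (rep U).obj} {f g : S ⟶ T}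
    (h : ∀ s, (rep U).p.map f s = (rep U).p.map g s) : f = g :=
  Over.OverMorphism.ext (by ext s; exact h s)

theorem repHom_map {S T : (rep U).obj} (f : S ⟶ T) (s : (rep U).p.obj S) :
    repHom T ((rep U).p.map f s) = repHom S s :=
  congrArg (fun g : (rep U).p.obj S ⟶ U ↦ g s) (Over.w f)

/-- The object of `sieveCat R` given by a map that belongs to `R`. -/
abbrev sieveMk {T : TopCat.{u}} (f : T ⟶ U) (hf : R f) : (sieveCat R).obj :=
  ⟨Over.mk f, hf⟩

/-- The structure map to `U` of an object of the category given by a sieve on `U`. -/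
abbrev sieveHom (S : (sieveCat R).obj) : (sieveCat R).p.obj S ⟶ U :=
  repHom ((sieveIncl R).obj S)

theorem sieveHom_mem (S : (sieveCat R).obj) : R (sieveHom S) :=
  S.property

/-- The arrow of the category given by a sieve on `U` that is given by a continuous map over `U`. -/
def sieveHomMk {S T : (sieveCat R).obj} (g : (sieveCat R).p.obj S ⟶ (sieveCat R).p.obj T)
    (h : ∀ s, sieveHom T (g s) = sieveHom S s) : S ⟶ T :=
  ObjectProperty.homMk (repHomMk g h)

theorem sieve_hom_ext {S T : (sieveCat R).obj} {f g : S ⟶ T}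
    (h : ∀ s, (sieveCat R).p.map f s = (sieveCat R).p.map g s) : f = g :=
  ObjectProperty.hom_ext _ (rep_hom_ext h)

theorem sieveHom_map {S T : (sieveCat R).obj} (f : S ⟶ T) (s : (sieveCat R).p.obj S) :
    sieveHom T ((sieveCat R).p.map f s) = sieveHom S s :=
  repHom_map ((sieveIncl R).map f) s

/-- The restriction of an object of the category given by a sieve to a subset. -/
abbrev sieveRestrict (S : (sieveCat R).obj) (W : Set ((sieveCat R).p.obj S)) : (sieveCat R).obj :=
  sieveMk (openIncl W ≫ sieveHom S) (R.downward_closed (sieveHom_mem S) _)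

end Objects

end TopStack
/-! ### Extending transformations from a covering sieve -/

namespace TopStack

variable {M : Type u} [TopologicalSpace M] {G : TopGroupoid M} {U : TopCat.{u}} {R : Sieve U}

/-- The sieve `R` contains the inclusion of an open neighbourhood of each point. -/
abbrev ContainsOpenCover (R : Sieve U) : Prop :=
  ∀ b : U, ∃ V : Set U, IsOpen V ∧ b ∈ V ∧ R (openIncl V)

theorem ContainsOpenCover.pointIncl_mem (hR : ContainsOpenCover R) (b : U) : R (pointIncl b) := by
  obtain ⟨V, -, hb, h⟩ := hR b
  exact sieve_of_range_subset h _ fun _ ↦ hb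

section Full

variable {K L : BasedFunctor (rep U) G.classifying}

/-- Each point of `K T` comes from an object of the sieve, namely the inclusion of a point. -/
theorem exists_sieve_point (hR : ContainsOpenCover R) {T : (rep U).obj}
    (x : (bundleAt K T).bundle.Tot) :
    ∃ (S : (sieveCat R).obj) (j : (sieveIncl R).obj S ⟶ T)
      (s : (bundleAt K ((sieveIncl R).obj S)).bundle.Tot), (bundleMap K j).tot s = x := by
  let t : (rep U).p.obj T := (bundleAt K T).bundle.proj x
  let S : (sieveCat R).obj := sieveMk (pointIncl (repHom T t)) (hR.pointIncl_mem _)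
  let j : (sieveIncl R).obj S ⟶ T := repHomMk (pointIncl t) fun _ ↦ rfl
  obtain ⟨s, -, hs⟩ := (bundleMap K j).exists_tot_eq PUnit.unit x rfl
  exact ⟨S, j, s, hs⟩

/-- Each object over `U` is covered by open subsets that belong to the sieve. -/
theorem exists_sieve_neighbourhood (hR : ContainsOpenCover R) {T : (rep U).obj}
    (t : (rep U).p.obj T) : ∃ W : Set ((rep U).p.obj T), IsOpen W ∧ t ∈ W ∧
      ∃ h : R (openIncl W ≫ repHom T), ∃ j : (sieveIncl R).obj (sieveMk _ h) ⟶ T,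
        (rep U).p.map j = openIncl W := by
  obtain ⟨V, hV, hb, h⟩ := hR (repHom T t)
  refine ⟨repHom T ⁻¹' V, hV.preimage (repHom T).hom.continuous, hb,
    sieve_of_range_subset h _ fun t ↦ t.2, repHomMk (openIncl _) fun _ ↦ rfl, rfl⟩

variable (β : (precomp (sieveIncl R) G.classifying).obj K ⟶
  (precomp (sieveIncl R) G.classifying).obj L)

/-- The component of `β` at an object of the sieve. -/
abbrev restrApp (S : (sieveCat R).obj) : bundleAt K ((sieveIncl R).obj S) ⟶
    bundleAt L ((sieveIncl R).obj S) :=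
  bundleApp β S

theorem restrApp_naturality {S S' : (sieveCat R).obj} (i : S ⟶ S')
    (s : (bundleAt K ((sieveIncl R).obj S)).bundle.Tot) :
    (restrApp β S').tot ((bundleMap K ((sieveIncl R).map i)).tot s) =
      (bundleMap L ((sieveIncl R).map i)).tot ((restrApp β S).tot s) :=
  bundleApp_naturality β i s

/-- The value at a point `x` of `K T` of the extension of `β`: the point `x` is the image of a point
`s` of some `K S` with `S` in the sieve, and the image of `β s` in `L T` does not depend on the
choice of `S` and `s`, because all choices can be compared with the one in which `S` is the
inclusion of a point. -/
theorem exists_extension_value (hR : ContainsOpenCover R) (T : (rep U).obj)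
    (x : (bundleAt K T).bundle.Tot) : ∃ y : (bundleAt L T).bundle.Tot,
      ∀ (S : (sieveCat R).obj) (j : (sieveIncl R).obj S ⟶ T)
      (s : (bundleAt K ((sieveIncl R).obj S)).bundle.Tot), (bundleMap K j).tot s = x →
        (bundleMap L j).tot ((restrApp β S).tot s) = y := by
  let t : (rep U).p.obj T := (bundleAt K T).bundle.proj x
  let S₀ : (sieveCat R).obj := sieveMk (pointIncl (repHom T t)) (hR.pointIncl_mem _)
  let j₀ : (sieveIncl R).obj S₀ ⟶ T := repHomMk (pointIncl t) fun _ ↦ rfl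
  obtain ⟨s₀, -, hs₀⟩ := (bundleMap K j₀).exists_tot_eq PUnit.unit x rfl
  refine ⟨(bundleMap L j₀).tot ((restrApp β S₀).tot s₀), fun S j s hs ↦ ?_⟩
  let c : (rep U).p.obj ((sieveIncl R).obj S) := (bundleAt K ((sieveIncl R).obj S)).bundle.proj s
  have hc : (rep U).p.map j c = t := by
    have := (bundleMap K j).proj_tot s
    rw [hs] at this
    exact this.symm
  let i : S₀ ⟶ S := sieveHomMk (pointIncl c) fun _ ↦ by
    have := repHom_map j c
    rw [hc] at this
    exact this.symm
  have hij : (sieveIncl R).map i ≫ j = j₀ := rep_hom_ext fun _ ↦ hc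
  obtain ⟨s₁, hs₁, hs₁'⟩ := (bundleMap K ((sieveIncl R).map i)).exists_tot_eq PUnit.unit s rfl
  obtain rfl : s₁ = s₀ := by
    refine (bundleMap K j₀).eq_of_proj_eq_of_tot_eq rfl ?_
    rw [← hij, bundleMap_comp_tot, hs₁', hs, hs₀.symm, hij]
  rw [← hij, bundleMap_comp_tot, ← restrApp_naturality, hs₁']

/-- Restriction to a covering sieve is full. -/
theorem exists_extension (hR : ContainsOpenCover R) :
    ∃ α : K ⟶ L, (precomp (sieveIncl R) G.classifying).map α = β := by
  choose A hA using exists_extension_value β hR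
  have key : ∀ (T : (rep U).obj) (x : (bundleAt K T).bundle.Tot),
      ∃ (S : (sieveCat R).obj) (j : (sieveIncl R).obj S ⟶ T)
      (s : (bundleAt K ((sieveIncl R).obj S)).bundle.Tot), (bundleMap K j).tot s = x ∧
        (bundleMap L j).tot ((restrApp β S).tot s) = A T x := fun T x ↦ by
    obtain ⟨S, j, s, hs⟩ := exists_sieve_point hR x
    exact ⟨S, j, s, hs, hA _ _ _ _ _ hs⟩
  have hcont : ∀ T, Continuous (A T) := by
    refine fun T ↦ continuous_of_locally fun x ↦ ?_
    obtain ⟨W, hW, hx, h, j, hj⟩ := exists_sieve_neighbourhood hR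
      (T := T) ((bundleAt K T).bundle.proj x)
    refine ⟨(bundleAt K T).bundle.proj ⁻¹' W, hW.preimage (bundleAt K T).bundle.continuous_proj,
      hx, ?_⟩
    obtain ⟨w, hw, -, hw'⟩ := (bundleMap K j).exists_lift
      (Z := (bundleAt K T).bundle.proj ⁻¹' W) (a := fun z ↦ ⟨(bundleAt K T).bundle.proj z, z.2⟩)
      (y := fun z ↦ z.1)
      (Continuous.subtype_mk ((bundleAt K T).bundle.continuous_proj.comp continuous_subtype_val) _)
      continuous_subtype_val fun z ↦ by rw [bundleMap_base, hj]; rfl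
    refine (continuous_congr fun z ↦ (hA _ _ _ j _ (hw' z)).symm).2 ?_
    exact (bundleMap L j).continuous_tot.comp ((restrApp β _).continuous_tot.comp hw)
  let η : ∀ T, bundleAt K T ⟶ bundleAt L T := fun T ↦
    { base := 𝟙 _
      tot := A T
      continuous_tot := hcont T
      proj_tot := fun x ↦ by
        obtain ⟨S, j, s, rfl, hs⟩ := key T x
        rw [← hs, (bundleMap L j).proj_tot, (restrApp β S).proj_tot, (bundleMap K j).proj_tot]
        rfl
      moment_tot := fun x ↦ by
        obtain ⟨S, j, s, rfl, hs⟩ := key T x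
        rw [← hs, (bundleMap L j).moment_tot, (restrApp β S).moment_tot,
          (bundleMap K j).moment_tot]
      tot_act := fun x γ e ↦ by
        obtain ⟨S, j, s, rfl, hs⟩ := key T x
        have e' := ((bundleMap K j).moment_tot s).symm.trans e
        rw [← hA _ _ S j _ ((bundleMap K j).tot_act s γ e'), (restrApp β S).tot_act,
          (bundleMap L j).tot_act]
        exact (bundleAt L T).bundle.act_congr hs rfl _ }
  refine ⟨natTransMk η (fun _ ↦ rfl) fun {T T'} f x ↦ ?_, natTrans_ext_tot fun S s ↦ ?_⟩
  · obtain ⟨S, j, s, rfl, hs⟩ := key T x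
    have h1 : A T' _ = _ := (hA T' _ S (j ≫ f) s (bundleMap_comp_tot K j f s)).symm
    have h2 : (bundleMap L f).tot (A T ((bundleMap K j).tot s)) = _ :=
      congrArg _ hs.symm
    exact h1.trans ((bundleMap_comp_tot L j f _).trans h2.symm)
  · have h1 := hA ((sieveIncl R).obj S) s S (𝟙 _) s (by
      have : K.map (𝟙 ((sieveIncl R).obj S)) = 𝟙 _ := K.map_id _
      exact congrFun (congrArg (BundleObj.Hom.tot (G := G)) this) s)
    have : L.map (𝟙 ((sieveIncl R).obj S)) = 𝟙 _ := L.map_id _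
    exact h1.symm.trans
      (congrFun (congrArg (BundleObj.Hom.tot (G := G)) this) ((restrApp β S).tot s))

/-- Restriction to a covering sieve is faithful. -/
theorem extension_unique (hR : ContainsOpenCover R) {α α' : K ⟶ L}
    (h : (precomp (sieveIncl R) G.classifying).map α =
      (precomp (sieveIncl R) G.classifying).map α') : α = α' := by
  refine natTrans_ext_tot fun T x ↦ ?_
  obtain ⟨S, j, s, rfl⟩ := exists_sieve_point hR x
  rw [bundleApp_naturality, bundleApp_naturality]
  have : restrApp ((precomp (sieveIncl R) G.classifying).map α) S =
    restrApp ((precomp (sieveIncl R) G.classifying).map α') S := by rw [h]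
  exact congrArg _ (congrFun (congrArg (BundleObj.Hom.tot (G := G)) this) s)

end Full

end TopStack
/-! ### Gluing principal bundles -/

namespace TopStack

variable {M : Type u} [TopologicalSpace M] {G : TopGroupoid M} {U : TopCat.{u}} {R : Sieve U}

namespace Glue

variable (K : BasedFunctor (sieveCat R) G.classifying) (hR : ContainsOpenCover R)

/-- The object of the category of the sieve `R` given by the inclusion of a point. -/
abbrev point (b : U) : (sieveCat R).obj :=
  sieveMk (pointIncl b) (hR.pointIncl_mem b)

/-- The arrow of the category of the sieve `R` given by a point of an object `S`. -/
def pointArrow (S : (sieveCat R).obj) (s : (sieveCat R).p.obj S) (b : U) (h : sieveHom S s = b) :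
    point hR b ⟶ S :=
  sieveHomMk (pointIncl s) fun _ ↦ h

/-- The total space of the bundle glued from the descent datum `K`: its fibre over a point `b` is
the value of `K` at the inclusion of `b`. It is a structure of its own, and not a sigma type,
because it does not carry the topology of a disjoint union. -/
structure Tot : Type u where
  /-- The base point. -/
  base : U
  /-- The point of the fibre. -/
  pt : (bundleAt K (point hR base)).bundle.Tot

/-- The projection of the glued bundle. -/
abbrev proj (q : Tot K hR) : U := q.1

/-- The moment map of the glued bundle. -/
abbrev moment (q : Tot K hR) : M :=
  (bundleAt K (point hR q.1)).bundle.moment q.2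

/-- The action on the glued bundle. -/
abbrev act (q : Tot K hR) (γ : G.Arr) (e : moment K hR q = G.tgt γ) : Tot K hR :=
  ⟨q.1, (bundleAt K (point hR q.1)).bundle.act q.2 γ e⟩

theorem exists_point (S : (sieveCat R).obj) (s : (bundleAt K S).bundle.Tot) :
    ∃ x : (bundleAt K (point hR (sieveHom S ((bundleAt K S).bundle.proj s)))).bundle.Tot,
      (bundleMap K (pointArrow hR S _ _ rfl)).tot x = s := by
  obtain ⟨x, -, hx⟩ :=
    (bundleMap K (pointArrow hR S _ _ rfl)).exists_tot_eq PUnit.unit s rfl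
  exact ⟨x, hx⟩

/-- The comparison map from the value of the descent datum at `S` to the glued bundle: it sends `s`
to the unique point of the fibre over the image of `s` in `U` that maps to `s`. -/
noncomputable def incl (S : (sieveCat R).obj) (s : (bundleAt K S).bundle.Tot) : Tot K hR :=
  ⟨_, (exists_point K hR S s).choose⟩

theorem proj_incl (S : (sieveCat R).obj) (s : (bundleAt K S).bundle.Tot) :
    proj K hR (incl K hR S s) = sieveHom S ((bundleAt K S).bundle.proj s) := rfl

theorem proj_bundleMap_pointArrow (S : (sieveCat R).obj) (c : (sieveCat R).p.obj S) (b : U)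
    (h : sieveHom S c = b) (x) :
    (bundleAt K S).bundle.proj ((bundleMap K (pointArrow hR S c b h)).tot x) = c :=
  (bundleMap K (pointArrow hR S c b h)).proj_tot x

/-- The comparison map inverts, fibrewise, the maps given by the points of `S`. -/
theorem incl_bundleMap_pointArrow (S : (sieveCat R).obj) (c : (sieveCat R).p.obj S) (b : U)
    (h : sieveHom S c = b) (x) :
    incl K hR S ((bundleMap K (pointArrow hR S c b h)).tot x) = ⟨b, x⟩ := by
  subst h
  have h1 := proj_bundleMap_pointArrow K hR S c _ rfl x
  have h2 := (exists_point K hR S ((bundleMap K (pointArrow hR S c _ rfl)).tot x)).choose_spec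
  unfold incl
  generalize (exists_point K hR S ((bundleMap K (pointArrow hR S c _ rfl)).tot x)).choose = x' at h2
  revert x' h2
  generalize hs : (bundleMap K (pointArrow hR S c _ rfl)).tot x = s at h1
  subst h1
  intro x' h2
  exact congrArg (Tot.mk _)
    ((bundleMap K (pointArrow hR S _ _ rfl)).eq_of_proj_eq_of_tot_eq rfl (h2.trans hs.symm))

theorem exists_eq_bundleMap_pointArrow (S : (sieveCat R).obj) (s : (bundleAt K S).bundle.Tot) :
    ∃ x, s = (bundleMap K (pointArrow hR S ((bundleAt K S).bundle.proj s) _ rfl)).tot x := by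
  obtain ⟨x, hx⟩ := exists_point K hR S s
  exact ⟨x, hx.symm⟩

theorem incl_bundleMap {S S' : (sieveCat R).obj} (g : S ⟶ S') (s : (bundleAt K S).bundle.Tot) :
    incl K hR S' ((bundleMap K g).tot s) = incl K hR S s := by
  obtain ⟨x, hx⟩ := exists_eq_bundleMap_pointArrow K hR S s
  generalize (bundleAt K S).bundle.proj s = c at x hx
  subst hx
  rw [incl_bundleMap_pointArrow, ← bundleMap_comp_tot]
  have : pointArrow hR S c _ rfl ≫ g =
      pointArrow hR S' ((sieveCat R).p.map g c) _ (sieveHom_map g c) :=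
    sieve_hom_ext fun _ ↦ rfl
  rw [this, incl_bundleMap_pointArrow]

/-- The comparison map of `S` is injective on the fibres of `K S`. -/
theorem incl_injective_on_fibre {S : (sieveCat R).obj} {s s' : (bundleAt K S).bundle.Tot}
    (hp : (bundleAt K S).bundle.proj s = (bundleAt K S).bundle.proj s')
    (h : incl K hR S s = incl K hR S s') : s = s' := by
  obtain ⟨x, hx⟩ := exists_eq_bundleMap_pointArrow K hR S s
  obtain ⟨x', hx'⟩ := exists_eq_bundleMap_pointArrow K hR S s'
  generalize (bundleAt K S).bundle.proj s = c at x hx hp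
  generalize (bundleAt K S).bundle.proj s' = c' at x' hx' hp
  subst hp hx hx'
  rw [incl_bundleMap_pointArrow, incl_bundleMap_pointArrow] at h
  obtain rfl : x = x' := by injection h
  rfl

theorem exists_incl_eq (S : (sieveCat R).obj) (c : (sieveCat R).p.obj S) (q : Tot K hR)
    (h : sieveHom S c = proj K hR q) :
    ∃ s, (bundleAt K S).bundle.proj s = c ∧ incl K hR S s = q :=
  ⟨_, proj_bundleMap_pointArrow K hR S c q.1 h q.2, incl_bundleMap_pointArrow K hR S c q.1 h q.2⟩

theorem moment_incl (S : (sieveCat R).obj) (s : (bundleAt K S).bundle.Tot) :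
    moment K hR (incl K hR S s) = (bundleAt K S).bundle.moment s := by
  obtain ⟨x, hx⟩ := exists_eq_bundleMap_pointArrow K hR S s
  generalize (bundleAt K S).bundle.proj s = c at x hx
  subst hx
  rw [incl_bundleMap_pointArrow]
  exact ((bundleMap K (pointArrow hR S c _ rfl)).moment_tot x).symm

theorem incl_act (S : (sieveCat R).obj) (s : (bundleAt K S).bundle.Tot) (γ : G.Arr)
    (e : (bundleAt K S).bundle.moment s = G.tgt γ) :
    incl K hR S ((bundleAt K S).bundle.act s γ e) =
      act K hR (incl K hR S s) γ ((moment_incl K hR S s).trans e) := by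
  obtain ⟨x, hx⟩ := exists_eq_bundleMap_pointArrow K hR S s
  generalize (bundleAt K S).bundle.proj s = c at x hx
  subst hx
  have e' := ((bundleMap K (pointArrow hR S c _ rfl)).moment_tot x).symm.trans e
  rw [← (bundleMap K (pointArrow hR S c _ rfl)).tot_act x γ e', incl_bundleMap_pointArrow]
  simp only [incl_bundleMap_pointArrow]

/-- The object of the category of the sieve `R` given by an open set whose inclusion belongs
to `R`. -/
abbrev openObj (V : {V : Set U // IsOpen V ∧ R (openIncl V)}) : (sieveCat R).obj :=
  sieveMk (openIncl V.1) V.2.2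

/-- The topology on the glued bundle: the finest one for which the comparison maps from the values
of the descent datum at open sets are continuous. -/
noncomputable instance : TopologicalSpace (Tot K hR) :=
  ⨆ V : {V : Set U // IsOpen V ∧ R (openIncl V)},
    TopologicalSpace.coinduced (incl K hR (openObj V)) inferInstance

theorem continuous_dom {Z : Type*} [TopologicalSpace Z] {f : Tot K hR → Z}
    (h : ∀ V : {V : Set U // IsOpen V ∧ R (openIncl V)},
      Continuous fun s ↦ f (incl K hR (openObj V) s)) : Continuous f :=
  continuous_iSup_dom.2 fun V ↦ continuous_coinduced_dom.2 (h V)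

theorem continuous_proj : Continuous (proj K hR) :=
  continuous_dom K hR fun V ↦
    continuous_subtype_val.comp (bundleAt K (openObj V)).bundle.continuous_proj

theorem continuous_moment : Continuous (moment K hR) :=
  continuous_dom K hR fun V ↦ (continuous_congr fun s ↦ moment_incl K hR _ s).2
    (bundleAt K (openObj V)).bundle.continuous_moment

/-- The comparison maps can be computed locally: if the restriction of `S` to `W` maps to `S'`,
there is a continuous map, defined on the part of `K S` over `W`, to `K S'` that is compatible with
the comparison maps to the glued bundle. -/
theorem exists_local_lift (S S' : (sieveCat R).obj) (W : Set ((sieveCat R).p.obj S))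
    (g : sieveRestrict S W ⟶ S') :
    ∃ w : (bundleAt K S).bundle.proj ⁻¹' W → (bundleAt K S').bundle.Tot, Continuous w ∧
      ∀ s, incl K hR S' (w s) = incl K hR S s := by
  let j : sieveRestrict S W ⟶ S := sieveHomMk (openIncl W) fun _ ↦ rfl
  obtain ⟨w, hw, -, hw'⟩ := (bundleMap K j).exists_lift
    (Z := (bundleAt K S).bundle.proj ⁻¹' W) (a := fun z ↦ ⟨(bundleAt K S).bundle.proj z, z.2⟩)
    (y := fun z ↦ z.1)
    (Continuous.subtype_mk ((bundleAt K S).bundle.continuous_proj.comp continuous_subtype_val) _)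
    continuous_subtype_val fun z ↦ rfl
  refine ⟨fun s ↦ (bundleMap K g).tot (w s), (bundleMap K g).continuous_tot.comp hw, fun s ↦ ?_⟩
  rw [incl_bundleMap, ← incl_bundleMap K hR j, hw']

theorem continuous_incl_openObj (V : {V : Set U // IsOpen V ∧ R (openIncl V)}) :
    Continuous (incl K hR (openObj V)) :=
  continuous_iff_coinduced_le.2 (le_iSup (fun V : {V : Set U // IsOpen V ∧ R (openIncl V)} ↦
    TopologicalSpace.coinduced (incl K hR (openObj V)) inferInstance) V)

theorem continuous_incl (S : (sieveCat R).obj) : Continuous (incl K hR S) := by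
  refine continuous_of_locally fun s ↦ ?_
  obtain ⟨V, hV, hb, hVR⟩ := hR (sieveHom S ((bundleAt K S).bundle.proj s))
  have hW : IsOpen (sieveHom S ⁻¹' V) := hV.preimage (sieveHom S).hom.continuous
  obtain ⟨w, hw, hw'⟩ := exists_local_lift K hR S (openObj ⟨V, hV, hVR⟩) (sieveHom S ⁻¹' V)
    (sieveHomMk (TopCat.ofHom ⟨fun t : (sieveHom S ⁻¹' V : Set _) ↦ (⟨sieveHom S t.1, t.2⟩ : V),
      Continuous.subtype_mk ((sieveHom S).hom.continuous.comp continuous_subtype_val) _⟩)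
      fun _ ↦ rfl)
  refine ⟨(bundleAt K S).bundle.proj ⁻¹' (sieveHom S ⁻¹' V),
    hW.preimage (bundleAt K S).bundle.continuous_proj, hb, ?_⟩
  exact (continuous_congr hw').1 ((continuous_incl_openObj K hR _).comp hw)

/-- Over an open set `V` the glued bundle is the value of the descent datum at `V`. The image of an
open set is open because its preimage in the value at another open set `W` can be computed in the
value at `V ∩ W`. -/
theorem isOpenEmbedding_incl_openObj (V : {V : Set U // IsOpen V ∧ R (openIncl V)}) :
    IsOpenEmbedding (incl K hR (openObj V)) := by
  refine .of_continuous_injective_isOpenMap (continuous_incl_openObj K hR V) ?_ ?_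
  · intro s s' h
    refine incl_injective_on_fibre K hR ?_ h
    exact Subtype.ext (congrArg (proj K hR) h)
  · intro O hO
    refine isOpen_iSup_iff.2 fun W ↦ isOpen_coinduced.2 ?_
    rw [isOpen_iff_forall_mem_open]
    rintro s ⟨s', hs', h⟩
    have hs : ((bundleAt K (openObj W)).bundle.proj s).1 ∈ V.1 := by
      have : ((bundleAt K (openObj V)).bundle.proj s').1 =
        ((bundleAt K (openObj W)).bundle.proj s).1 := congrArg (proj K hR) h
      rw [← this]
      exact ((bundleAt K (openObj V)).bundle.proj s').2
    let Z : Set W.1 := Subtype.val ⁻¹' V.1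
    have hZ : IsOpen Z := V.2.1.preimage continuous_subtype_val
    obtain ⟨w, hw, hw'⟩ := exists_local_lift K hR (openObj W) (openObj V) Z
      (sieveHomMk (TopCat.ofHom ⟨fun t : Z ↦ (⟨t.1.1, t.2⟩ : V.1), by fun_prop⟩) fun _ ↦ rfl)
    have hop : IsOpen ((bundleAt K (openObj W)).bundle.proj ⁻¹' Z) :=
      hZ.preimage (bundleAt K (openObj W)).bundle.continuous_proj
    refine ⟨Subtype.val '' (w ⁻¹' O), ?_, hop.isOpenMap_subtype_val _ (hO.preimage hw),
      ⟨⟨s, hs⟩, ?_, rfl⟩⟩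
    · rintro _ ⟨z, hz, rfl⟩
      exact ⟨w z, hz, hw' z⟩
    · have : w ⟨s, hs⟩ = s' := by
        have e := (hw' ⟨s, hs⟩).trans h.symm
        exact incl_injective_on_fibre K hR (Subtype.ext (congrArg (proj K hR) e)) e
      rw [Set.mem_preimage, this]
      exact hs'

/-- Over an open set whose inclusion belongs to the sieve, the comparison map has a continuous
inverse. -/
theorem exists_retraction (b : U) : ∃ V : {V : Set U // IsOpen V ∧ R (openIncl V)}, b ∈ V.1 ∧
    ∃ r : proj K hR ⁻¹' V.1 → (bundleAt K (openObj V)).bundle.Tot, Continuous r ∧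
      ∀ q, incl K hR (openObj V) (r q) = q := by
  obtain ⟨V, hV, hb, hVR⟩ := hR b
  refine ⟨⟨V, hV, hVR⟩, hb, ?_⟩
  choose r _ hr using fun q : proj K hR ⁻¹' V ↦
    exists_incl_eq K hR (openObj ⟨V, hV, hVR⟩) ⟨proj K hR q, q.2⟩ q.1 rfl
  refine ⟨r, ?_, hr⟩
  rw [(isOpenEmbedding_incl_openObj K hR ⟨V, hV, hVR⟩).isEmbedding.continuous_iff]
  exact (continuous_congr hr).2 continuous_subtype_val

theorem moment_act (q : Tot K hR) (γ : G.Arr) (e : moment K hR q = G.tgt γ) :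
    moment K hR (act K hR q γ e) = G.src γ :=
  (bundleAt K (point hR q.1)).bundle.moment_act _ _ _

theorem continuous_act : Continuous
    fun x : {x : Tot K hR × G.Arr // moment K hR x.1 = G.tgt x.2} ↦
      act K hR x.1.1 x.1.2 x.2 := by
  refine continuous_of_locally fun x ↦ ?_
  obtain ⟨V, hb, r, hr, hr'⟩ := exists_retraction K hR (proj K hR x.1.1)
  refine ⟨{x | proj K hR x.1.1 ∈ V.1}, V.2.1.preimage ((continuous_proj K hR).comp (by fun_prop)),
    hb, ?_⟩
  have e : ∀ w : {x : {x : Tot K hR × G.Arr // moment K hR x.1 = G.tgt x.2} |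
      proj K hR x.1.1 ∈ V.1},
      (bundleAt K (openObj V)).bundle.moment (r ⟨w.1.1.1, w.2⟩) = G.tgt w.1.1.2 := fun w ↦ by
    rw [← moment_incl K hR, hr']
    exact w.1.2
  refine (continuous_congr fun w ↦ ?_).2 ((continuous_incl_openObj K hR V).comp
    ((bundleAt K (openObj V)).bundle.continuous_act' (hr.comp (by fun_prop)) (by fun_prop) e))
  have h := incl_act K hR (openObj V) _ _ (e w)
  simp only [hr'] at h
  exact h.symm

/-- The bundle over `U` glued from a descent datum. -/
noncomputable def bundle : PrincipalBundle G U where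
  Tot := Tot K hR
  proj := proj K hR
  continuous_proj := continuous_proj K hR
  hasLocalSections b := by
    obtain ⟨V, hV, hb, hVR⟩ := hR b
    obtain ⟨W, hW, hbW, s, hs, hs'⟩ :=
      (bundleAt K (openObj ⟨V, hV, hVR⟩)).bundle.hasLocalSections ⟨b, hb⟩
    have hin : ∀ v : (Subtype.val '' W : Set U), ∃ h : v.1 ∈ V, (⟨v.1, h⟩ : V) ∈ W := by
      rintro ⟨_, w, hw, rfl⟩
      exact ⟨w.2, hw⟩
    refine ⟨Subtype.val '' W, hV.isOpenMap_subtype_val W hW, ⟨_, hbW, rfl⟩,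
      fun v ↦ incl K hR (openObj ⟨V, hV, hVR⟩) (s ⟨⟨v.1, (hin v).1⟩, (hin v).2⟩),
      (continuous_incl_openObj K hR _).comp (hs.comp (by fun_prop)), fun v ↦ ?_⟩
    rw [proj_incl, hs']
    rfl
  moment := moment K hR
  continuous_moment := continuous_moment K hR
  act := act K hR
  continuous_act := continuous_act K hR
  moment_act := moment_act K hR
  act_one q := congrArg (Tot.mk _) ((bundleAt K (point hR q.1)).bundle.act_one _)
  act_act q γ γ' e e' := congrArg (Tot.mk _) ((bundleAt K (point hR q.1)).bundle.act_act _ _ _ _ e')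
  proj_act _ _ _ := rfl
  isHomeomorph := by
    refine PrincipalBundle.isHomeomorph_of_local_div (proj := proj K hR) (continuous_proj K hR)
      (continuous_act K hR) (fun _ _ _ ↦ rfl) ?_ ?_
    · intro q γ γ' e e' h
      have h' : (bundleAt K (point hR q.1)).bundle.act q.2 γ e =
        (bundleAt K (point hR q.1)).bundle.act q.2 γ' e' := by injection h
      exact (bundleAt K (point hR q.1)).bundle.act_free h'
    · intro b
      obtain ⟨V, hb, r, hr, hr'⟩ := exists_retraction K hR b
      obtain ⟨d, hd, hdiv⟩ := (bundleAt K (openObj V)).bundle.exists_div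
      have hp : ∀ q, ((bundleAt K (openObj V)).bundle.proj (r q)).1 = proj K hR q.1 := fun q ↦
        congrArg (proj K hR) (hr' q)
      let r1 : {y : {y : Tot K hR × Tot K hR // proj K hR y.1 = proj K hR y.2} //
          proj K hR y.1.1 ∈ V.1} → (bundleAt K (openObj V)).bundle.Tot := fun y ↦
        r ⟨y.1.1.1, y.2⟩
      let r2 : {y : {y : Tot K hR × Tot K hR // proj K hR y.1 = proj K hR y.2} //
          proj K hR y.1.1 ∈ V.1} → (bundleAt K (openObj V)).bundle.Tot := fun y ↦
        r ⟨y.1.1.2, by rw [Set.mem_preimage, ← y.1.2]; exact y.2⟩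
      have hr12 : ∀ y, (bundleAt K (openObj V)).bundle.proj (r1 y) =
          (bundleAt K (openObj V)).bundle.proj (r2 y) := fun y ↦
        Subtype.ext ((hp ⟨y.1.1.1, y.2⟩).trans (y.1.2.trans (hp ⟨y.1.1.2, _⟩).symm))
      refine ⟨V.1, V.2.1, hb, fun y ↦ d ⟨(r1 y, r2 y), hr12 y⟩, hd.comp
        (Continuous.subtype_mk (Continuous.prodMk (hr.comp (by fun_prop))
          (hr.comp (by fun_prop))) _), fun y ↦ ?_⟩
      obtain ⟨e, he⟩ := hdiv ⟨(r1 y, r2 y), hr12 y⟩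
      have h1 : incl K hR (openObj V) (r1 y) = y.1.1.1 := hr' _
      have h2 : incl K hR (openObj V) (r2 y) = y.1.1.2 := hr' _
      have h3 := incl_act K hR (openObj V) _ _ e
      rw [he] at h3
      simp only [h1, h2] at h3
      exact ⟨_, h3.symm⟩

/-- The glued bundle restricts to the given descent datum. -/
theorem nonempty_iso : Nonempty
    ((precomp (sieveIncl R) G.classifying).obj (ofBundle (bundle K hR)) ≅ K) := by
  let η : ∀ S, bundleAt K S ⟶
      bundleAt ((precomp (sieveIncl R) G.classifying).obj (ofBundle (bundle K hR))) S := fun S ↦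
    { base := 𝟙 _
      tot := fun s ↦ ⟨((bundleAt K S).bundle.proj s, incl K hR S s), rfl⟩
      continuous_tot := Continuous.subtype_mk ((bundleAt K S).bundle.continuous_proj.prodMk
        (continuous_incl K hR S)) _
      proj_tot := fun s ↦ rfl
      moment_tot := fun s ↦ moment_incl K hR S s
      tot_act := fun s γ e ↦ Subtype.ext (Prod.ext ((bundleAt K S).bundle.proj_act _ _ _)
        (incl_act K hR S s γ e)) }
  let α : K ⟶ (precomp (sieveIncl R) G.classifying).obj (ofBundle (bundle K hR)) :=
    natTransMk η (fun _ ↦ rfl) fun {S S'} g s ↦ Subtype.ext (Prod.ext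
      ((bundleMap K g).proj_tot s) (incl_bundleMap K hR g s))
  have := G.allCartesian_classifying.isIso_natTrans α
  exact ⟨(asIso α).symm⟩

end Glue

/-- Principal `G`-bundles form a stack: restriction to a covering sieve is faithful, full and
essentially surjective. -/
theorem isStack_classifying (G : TopGroupoid M) : IsStack G.classifying where
  isFiberedInGroupoids := G.isFiberedInGroupoids_classifying
  descent U R hR := by
    have hR' : ContainsOpenCover R := exists_openIncl_mem hR
    have h1 : (precomp (sieveIncl R) G.classifying).Faithful :=
      ⟨fun h ↦ extension_unique hR' h⟩
    have h2 : (precomp (sieveIncl R) G.classifying).Full :=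
      ⟨fun β ↦ exists_extension β hR'⟩
    have h3 : (precomp (sieveIncl R) G.classifying).EssSurj :=
      ⟨fun K ↦ ⟨_, Glue.nonempty_iso K hR'⟩⟩
    exact { }

theorem isTopologicalStack_classifying (G : TopGroupoid M) : IsTopologicalStack G.classifying where
  isStack := isStack_classifying G
  exists_groupoid := ⟨M, inferInstance, G, BasedFunctor.id _, BasedFunctor.id _,
    ⟨Iso.refl _⟩, ⟨Iso.refl _⟩⟩

end TopStack
/-! ### Epimorphisms -/

namespace TopStack

section FiberProductProj

variable {𝒴 𝒵 𝒳 : BasedCategory.{u, u + 1} TopCat.{u}} (f : BasedFunctor 𝒴 𝒳)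
  (g : BasedFunctor 𝒵 𝒳)

/-- The first projection of a 2-fibre product. -/
def fiberFst : BasedFunctor (fiberProduct f g) 𝒴 where
  obj a := FiberProductObj.fst a
  map k := FiberProductObj.Hom.fst k
  map_id _ := rfl
  map_comp _ _ := rfl
  w := rfl

/-- The second projection of a 2-fibre product. -/
def fiberSnd : BasedFunctor (fiberProduct f g) 𝒵 where
  obj a := FiberProductObj.snd a
  map k := FiberProductObj.Hom.snd k
  map_id _ := rfl
  map_comp _ _ := rfl
  w := by
    refine CategoryTheory.Functor.ext (fun a ↦ (FiberProductObj.base_eq a).symm) fun a b k ↦ ?_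
    have := FiberProductObj.Hom.isHomLift k
    exact IsHomLift.fac' 𝒵.p (𝒴.p.map (FiberProductObj.Hom.fst k)) (FiberProductObj.Hom.snd k)

/-- The universal 2-arrow of a 2-fibre product. -/
def fiberArrow : (fiberFst f g).comp f ⟶ (fiberSnd f g).comp g where
  app a := FiberProductObj.arrow a
  naturality _ _ k := FiberProductObj.Hom.comm k
  isHomLift' a := FiberProductObj.isHomLift a

variable {f g}

/-- An object `(y, z, φ)` of `𝒴 ×_𝒳 𝒴` is isomorphic to the diagonal object of `y` by means of an
isomorphism `α : y ≅ z` over the identity that induces `φ`. -/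
noncomputable def diagonalObjIso (b : FiberProductObj f f) (α : b.fst ⟶ b.snd) [IsIso α]
    [𝒴.p.IsHomLift (𝟙 (𝒴.p.obj b.fst)) α] (h : f.map α = b.arrow) :
    (⟨b.fst, b.fst, 𝟙 _, rfl, inferInstance⟩ : FiberProductObj f f) ≅ b where
  hom :=
    { fst := 𝟙 _
      snd := α
      isHomLift := by
        rw [CategoryTheory.Functor.map_id]
        infer_instance
      comm := by
        rw [CategoryTheory.Functor.map_id, Category.id_comp, Category.id_comp, h] }
  inv :=
    { fst := 𝟙 _
      snd := CategoryTheory.inv α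
      isHomLift := by
        rw [CategoryTheory.Functor.map_id]
        infer_instance
      comm := by
        rw [CategoryTheory.Functor.map_id, Category.id_comp, ← h, ← Functor.map_comp,
          IsIso.hom_inv_id, CategoryTheory.Functor.map_id] }
  hom_inv_id := FiberProductObj.Hom.ext (Category.comp_id _) (IsIso.hom_inv_id α)
  inv_hom_id := FiberProductObj.Hom.ext (Category.comp_id _) (IsIso.inv_hom_id α)

/-- A functor `N` to `𝒴 ×_𝒳 𝒴` factors up to isomorphism through the diagonal as soon as its two
projections are isomorphic by an isomorphism that induces the universal 2-arrow. -/
theorem nonempty_iso_diagonal {𝒲 : BasedCategory.{u, u + 1} TopCat.{u}}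
    (N : BasedFunctor 𝒲 (fiberProduct f f))
    (α : N.comp (fiberFst f f) ⟶ N.comp (fiberSnd f f)) (hiso : IsIso α)
    (h : BasedCategory.whiskerRight α f = BasedCategory.whiskerLeft N (fiberArrow f f)) :
    Nonempty ((N.comp (fiberFst f f)).comp (diagonal f) ≅ N) := by
  have hα : ∀ a, IsIso (α.toNatTrans.app a) := fun a ↦
    have : IsIso (X := (N.comp (fiberFst f f)).toFunctor) α.toNatTrans := inferInstance
    inferInstance
  let n : 𝒲.obj → FiberProductObj f f := fun a ↦ N.obj a
  have hn : ∀ a, 𝒴.p.obj (n a).fst = 𝒲.p.obj a := N.w_obj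
  let α' : ∀ a, (n a).fst ⟶ (n a).snd := fun a ↦ α.toNatTrans.app a
  have hlift : ∀ a, 𝒴.p.IsHomLift (𝟙 (𝒲.p.obj a)) (α' a) := α.isHomLift'
  have hlift' : ∀ a, 𝒴.p.IsHomLift (𝟙 (𝒴.p.obj (n a).fst)) (α' a) := fun a ↦ by
    rw [hn]
    exact hlift a
  have hα' : ∀ a, IsIso (α' a) := hα
  have h' : ∀ a, f.map (α' a) = (n a).arrow := fun a ↦
    congrArg (fun β : (N.comp (fiberFst f f)).comp f ⟶ (N.comp (fiberSnd f f)).comp f ↦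
      β.toNatTrans.app a) h
  let e : ((N.comp (fiberFst f f)).comp (diagonal f)).toFunctor ≅ N.toFunctor :=
    NatIso.ofComponents (fun a ↦ diagonalObjIso (n a) (α' a) (h' a))
      (fun {a b} k ↦ FiberProductObj.Hom.ext
        ((Category.comp_id _).trans (Category.id_comp _).symm) (α.toNatTrans.naturality k))
  refine ⟨BasedNatIso.mkNatIso e fun a ↦ ?_⟩
  refine IsHomLift.of_fac (fiberProduct f f).p _ _ (hn a) (hn a) ?_
  have key : ∀ {S T : TopCat.{u}} (h : S = T) (g : S ⟶ S), g = 𝟙 S →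
      𝟙 T = eqToHom h.symm ≫ g ≫ eqToHom h := by
    rintro S _ rfl _ rfl
    simp
  exact key (hn a) _ (𝒴.p.map_id _)

end FiberProductProj

variable {M : Type u} [TopologicalSpace M] {G : TopGroupoid M}

section Sections

variable {U V : TopCat.{u}} {K L : BasedFunctor (rep U) G.classifying}

/-- A morphism between the bundles over `U` given by two functors extends to a transformation. -/
theorem exists_natTrans_of_bundleHom (f : bundleAt K (repMk (𝟙 U)) ⟶ bundleAt L (repMk (𝟙 U)))
    (hf : f.base = 𝟙 _) : ∃ α : K ⟶ L, (bundleApp α (repMk (𝟙 U))).tot = f.tot := by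
  have h : G.classifying.p.IsHomLift (𝟙 U) (BundleObj.uncastHom (K.w_obj (repMk (𝟙 U)))
      (L.w_obj (repMk (𝟙 U))) f) := by
    have := BundleObj.isHomLift_uncastHom (K.w_obj (repMk (𝟙 U))) (L.w_obj (repMk (𝟙 U))) f
    rw [hf] at this
    exact this
  obtain ⟨α, hα⟩ := G.allCartesian_classifying.exists_natTrans (K := K) (L := L) _ h
  have h' := congrArg (BundleObj.Hom.tot (G := G)) hα
  exact ⟨α, h'⟩

/-- Two transformations agree if they agree on a section of the source. -/
theorem natTrans_ext_of_section {α β : K ⟶ L}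
    {s : U → (bundleAt K (repMk (𝟙 U))).bundle.Tot}
    (hs : ∀ b, (bundleAt K (repMk (𝟙 U))).bundle.proj (s b) = b)
    (h : ∀ b, (bundleApp α (repMk (𝟙 U))).tot (s b) = (bundleApp β (repMk (𝟙 U))).tot (s b)) :
    α = β := by
  have key : bundleApp α (repMk (𝟙 U)) = bundleApp β (repMk (𝟙 U)) :=
    BundleObj.Hom.ext_of_section rfl hs h
  have key' := congrArg BundleObj.Hom.tot key
  exact G.allCartesian_classifying.natTrans_ext (BundleObj.hom_ext_of_isHomLift (𝟙 U)
    (α.isHomLift' (repMk (𝟙 U))) (β.isHomLift' (repMk (𝟙 U))) key')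

/-- The bundle morphism over `σ : V → U` from the bundle over `V` given by the restriction of `K`
along `σ` to the bundle over `U` given by `K`. -/
def restrictMap (σ : V ⟶ U) (K : BasedFunctor (rep U) G.classifying) :
    bundleAt ((repMap σ).comp K) (repMk (𝟙 V)) ⟶ bundleAt K (repMk (𝟙 U)) :=
  bundleMap K (toTerminal ((repMap σ).obj (repMk (𝟙 V))))

/-- A section of the bundle over `U` along `σ` lifts to a section of the restricted bundle. -/
theorem exists_restrict_section (σ : V ⟶ U) (K : BasedFunctor (rep U) G.classifying)
    {s : V → (bundleAt K (repMk (𝟙 U))).bundle.Tot} (hs : Continuous s)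
    (hs' : ∀ v, (bundleAt K (repMk (𝟙 U))).bundle.proj (s v) = σ v) :
    ∃ t : V → (bundleAt ((repMap σ).comp K) (repMk (𝟙 V))).bundle.Tot, Continuous t ∧
      (∀ v, (bundleAt ((repMap σ).comp K) (repMk (𝟙 V))).bundle.proj (t v) = v) ∧
      ∀ v, (restrictMap σ K).tot (t v) = s v :=
  (restrictMap σ K).exists_lift (Z := V) (a := id) continuous_id hs hs'

end Sections

section Epi

variable {H : TopGroupoid M} (F : TopGroupoid.Hom G H)

/-- Locally on `U`, a principal `H`-bundle has a section, and it is then associated to the trivial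
principal `G`-bundle along the moment of that section. -/
theorem isEpi_classifyingMap (hF : ∀ m, F.obj m = m) : IsEpi F.classifyingMap := by
  intro U q
  choose V hV hb s hs hs' using (bundleAt q (repMk (𝟙 U))).bundle.hasLocalSections
  refine ⟨U, fun u ↦ TopCat.of (V u), fun u ↦ openIncl (V u),
    ofArrows_openIncl_mem_precoverage hV fun b ↦ ⟨b, hb b⟩, fun u ↦ ?_⟩
  obtain ⟨t, ht, ht', -⟩ := exists_restrict_section (openIncl (V u)) q (hs u) (hs' u)
  let Y := bundleAt ((repMap (openIncl (V u))).comp q) (repMk (𝟙 (TopCat.of (V u))))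
  have hm : Continuous fun v : V u ↦ Y.bundle.moment (t v) := Y.bundle.continuous_moment.comp ht
  let P : PrincipalBundle G (TopCat.of (V u)) := PrincipalBundle.trivial G hm
  have e : ∀ x : {x : V u × G.Arr // Y.bundle.moment (t x.1) = G.tgt x.2},
      Y.bundle.moment (t x.1.1) = H.tgt (F.arr x.1.2) := fun x ↦ by
    rw [F.tgt_arr, hF]
    exact x.2
  let t' : P.Tot → Y.bundle.Tot :=
    fun x : {x : V u × G.Arr // Y.bundle.moment (t x.1) = G.tgt x.2} ↦
      Y.bundle.act (t x.1.1) (F.arr x.1.2) (e x)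
  have ct' : Continuous t' := Y.bundle.continuous_act' (ht.comp (by fun_prop))
    (F.continuous_arr.comp (by fun_prop)) e
  -- The value of `ofBundle P` at the identity is the pullback of `P` along the identity.
  obtain ⟨g, hg⟩ := BundleObj.exists_assoc_desc F
    (⟨_, P.pullback (f := id) continuous_id⟩ : BundleObj G) Y (𝟙 _)
    (t := fun x ↦ t' x.1.2) (ct'.comp (by fun_prop))
    (fun x ↦ (Y.bundle.proj_act _ _ _).trans ((ht' _).trans x.2))
    (fun x ↦ (Y.bundle.moment_act _ _ _).trans (F.src_arr _))
    (fun x γ e' ↦ by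
      refine Eq.trans ?_ (Y.bundle.act_act _ _ _ (e x.1.2) (by
        rw [F.src_arr, F.tgt_arr]; exact congrArg _ e')).symm
      exact Y.bundle.act_congr rfl (F.arr_comp _ _ _) _)
  obtain ⟨α, -⟩ := exists_natTrans_of_bundleHom (K := (ofBundle P).comp F.classifyingMap)
    (L := (repMap (openIncl (V u))).comp q) g hg
  have := H.allCartesian_classifying.isIso_natTrans α
  let i := asIso α
  exact ⟨ofBundle P, ⟨i⟩⟩

/-- The unit section `p ↦ [p, 1]` of the associated bundle. -/
def assocUnit {B : Type u} [TopologicalSpace B] (P : PrincipalBundle G B) (x : P.Tot) :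
    (P.assoc F).Tot :=
  (⟦⟨(x, H.one (F.obj (P.moment x))), (H.tgt_one _).symm⟩⟧ : PrincipalBundle.AssocTot F P)

theorem continuous_assocUnit {B : Type u} [TopologicalSpace B] (P : PrincipalBundle G B) :
    Continuous (assocUnit F P) :=
  continuous_quotient_mk'.comp (Continuous.subtype_mk (continuous_id.prodMk
    (H.continuous_one.comp (F.continuous_obj.comp P.continuous_moment))) _)

theorem moment_assocUnit {B : Type u} [TopologicalSpace B] (P : PrincipalBundle G B) (x : P.Tot) :
    (P.assoc F).moment (assocUnit F P x) = F.obj (P.moment x) :=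
  H.src_one _

theorem assocMap_assocUnit {X Y : BundleObj G} (f : X ⟶ Y) (x : X.bundle.Tot) :
    (BundleObj.assocMap F f).tot (assocUnit F X.bundle x) = assocUnit F Y.bundle (f.tot x) :=
  congrArg (Quotient.mk (PrincipalBundle.assocSetoid F Y.bundle)) (Subtype.ext (Prod.ext rfl
    (congrArg (fun m ↦ H.one (F.obj m)) (f.moment_tot x).symm)))

theorem assocUnit_act {B : Type u} [TopologicalSpace B] (P : PrincipalBundle G B) (x : P.Tot)
    (γ : G.Arr) (e : P.moment x = G.tgt γ)
    (e' : (P.assoc F).moment (assocUnit F P x) = H.tgt (F.arr γ)) :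
    assocUnit F P (P.act x γ e) = (P.assoc F).act (assocUnit F P x) (F.arr γ) e' := by
  refine Eq.symm (Quotient.sound ⟨γ, e, ?_, rfl, ?_⟩)
  · rw [F.src_arr, H.tgt_one, P.moment_act]
  · have h1 : ∀ (m : M) (hm : H.src (F.arr γ) = H.tgt (H.one m)),
        H.comp (F.arr γ) (H.one m) hm = F.arr γ := by
      intro m hm
      obtain rfl : m = H.src (F.arr γ) := by rw [hm, H.tgt_one]
      exact H.comp_one _
    exact (h1 _ _).trans (H.one_comp' _).symm

/-- Forming the associated bundle commutes with transport along an equality of base spaces. -/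
theorem proj_bundleAt_comp {𝒳 : BasedCategory.{u, u + 1} TopCat.{u}}
    (K : BasedFunctor 𝒳 G.classifying) (a : 𝒳.obj)
    (z : ((bundleAt K a).bundle.assoc F).Tot) :
    (bundleAt (K.comp F.classifyingMap) a).bundle.proj z =
      ((bundleAt K a).bundle.assoc F).proj z := by
  induction z using Quotient.inductionOn with
  | h x => rfl

theorem bundleMap_assocUnit {𝒳 : BasedCategory.{u, u + 1} TopCat.{u}}
    (K : BasedFunctor 𝒳 G.classifying) {a b : 𝒳.obj} (f : a ⟶ b)
    (x : (bundleAt K a).bundle.Tot) :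
    (bundleMap (K.comp F.classifyingMap) f).tot (assocUnit F (bundleAt K a).bundle x) =
      assocUnit F (bundleAt K b).bundle ((bundleMap K f).tot x) :=
  assocMap_assocUnit F (X := bundleAt K a) (Y := bundleAt K b) (bundleMap K f) x

theorem bundleApp_whiskerRight_assocUnit {𝒳 : BasedCategory.{u, u + 1} TopCat.{u}}
    {K L : BasedFunctor 𝒳 G.classifying} (α : K ⟶ L) (a : 𝒳.obj)
    (x : (bundleAt K a).bundle.Tot) :
    (bundleApp (BasedCategory.whiskerRight α F.classifyingMap) a).tot
        (assocUnit F (bundleAt K a).bundle x) =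
      assocUnit F (bundleAt L a).bundle ((bundleApp α a).tot x) :=
  assocMap_assocUnit F (X := bundleAt K a) (Y := bundleAt L a) (bundleApp α a) x

variable {F}

/-- Locally, an isomorphism `θ` between the associated bundles of two principal `G`-bundles is
induced by an isomorphism of the `G`-bundles: there are local sections `s` and `s'` with the same
moments such that `θ [s, 1] = [s', 1]`. Choosing the sections arbitrarily, one has
`θ [s, 1] = [s', δ]` for a continuous map `δ` to the arrows of `H`, which lifts locally to a map `γ`
to the arrows of `G`; then `s' · γ` is the desired section. -/
theorem exists_sections_of_assoc_hom (hF : F.IsExtension) {B : Type u} [TopologicalSpace B]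
    {X Y : PrincipalBundle G B}
    {θ : (X.assoc F).Tot → (Y.assoc F).Tot} (hθ : Continuous θ)
    (hθp : ∀ z, (Y.assoc F).proj (θ z) = (X.assoc F).proj z)
    (hθm : ∀ z, (Y.assoc F).moment (θ z) = (X.assoc F).moment z) (b : B) :
    ∃ V : Set B, IsOpen V ∧ b ∈ V ∧ ∃ (s : V → X.Tot) (s' : V → Y.Tot), Continuous s ∧
      Continuous s' ∧ (∀ v, X.proj (s v) = v) ∧ (∀ v, Y.proj (s' v) = v) ∧
      (∀ v, Y.moment (s' v) = X.moment (s v)) ∧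
      ∀ v, θ (assocUnit F X (s v)) = assocUnit F Y (s' v) := by
  obtain ⟨V₁, hV₁, hb₁, s, hs, hs'⟩ := X.hasLocalSections b
  obtain ⟨V₂, hV₂, hb₂, t, ht, ht'⟩ := Y.hasLocalSections b
  obtain ⟨d, hd, hdiv⟩ := (Y.assoc F).exists_div
  have h0 : ∀ v : (V₁ ∩ V₂ : Set B), (Y.assoc F).proj (assocUnit F Y (t ⟨v, v.2.2⟩)) =
      (Y.assoc F).proj (θ (assocUnit F X (s ⟨v, v.2.1⟩))) := fun v ↦ by
    exact (ht' _).trans ((hs' ⟨v, v.2.1⟩).symm.trans (hθp (assocUnit F X (s ⟨v, v.2.1⟩))).symm)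
  let δ : (V₁ ∩ V₂ : Set B) → H.Arr := fun v ↦ d ⟨(_, _), h0 v⟩
  have hδ : Continuous δ := by
    refine hd.comp (Continuous.subtype_mk (Continuous.prodMk ?_ ?_) _)
    · exact (continuous_assocUnit F Y).comp (ht.comp (by fun_prop))
    · exact hθ.comp ((continuous_assocUnit F X).comp (hs.comp (by fun_prop)))
  have hδ1 : ∀ v : (V₁ ∩ V₂ : Set B),
      (Y.assoc F).moment (assocUnit F Y (t ⟨v, v.2.2⟩)) = H.tgt (δ v) := fun v ↦
    (hdiv ⟨(_, _), h0 v⟩).1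
  have hδ2 : ∀ v : (V₁ ∩ V₂ : Set B),
      (Y.assoc F).act _ (δ v) (hδ1 v) = θ (assocUnit F X (s ⟨v, v.2.1⟩)) := fun v ↦
    (hdiv ⟨(_, _), h0 v⟩).2
  obtain ⟨W, hW, hbW, l, hl, hl'⟩ := hF.hasLocalSections (δ ⟨b, hb₁, hb₂⟩)
  have hin : ∀ v : (Subtype.val '' (δ ⁻¹' W) : Set B),
      ∃ h : v.1 ∈ V₁ ∩ V₂, δ ⟨v.1, h⟩ ∈ W := by
    rintro ⟨_, w, hw, rfl⟩
    exact ⟨w.2, hw⟩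
  let i : (Subtype.val '' (δ ⁻¹' W) : Set B) → (V₁ ∩ V₂ : Set B) := fun v ↦ ⟨v, (hin v).1⟩
  have hi : Continuous i := by fun_prop
  let γ : (Subtype.val '' (δ ⁻¹' W) : Set B) → G.Arr := fun v ↦ l ⟨δ (i v), (hin v).2⟩
  have hγ : Continuous γ := hl.comp (Continuous.subtype_mk (hδ.comp hi) _)
  have hFγ : ∀ v, F.arr (γ v) = δ (i v) := fun v ↦ hl' _
  have e : ∀ v, Y.moment (t ⟨i v, (i v).2.2⟩) = G.tgt (γ v) := fun v ↦ by
    have := hδ1 (i v)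
    rwa [moment_assocUnit, hF.obj_eq, ← hFγ, F.tgt_arr, hF.obj_eq] at this
  refine ⟨Subtype.val '' (δ ⁻¹' W), (hV₁.inter hV₂).isOpenMap_subtype_val _ (hW.preimage hδ),
    ⟨⟨b, hb₁, hb₂⟩, hbW, rfl⟩, fun v ↦ s ⟨i v, (i v).2.1⟩,
    fun v ↦ Y.act (t ⟨i v, (i v).2.2⟩) (γ v) (e v), hs.comp (by fun_prop),
    Y.continuous_act' (ht.comp (by fun_prop)) hγ _, fun v ↦ hs' _,
    fun v ↦ (Y.proj_act _ _ _).trans (ht' _), fun v ↦ ?_, fun v ↦ ?_⟩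
  · have h1 : (Y.assoc F).moment ((Y.assoc F).act _ (δ (i v)) (hδ1 (i v))) = _ :=
      congrArg _ (hδ2 (i v))
    rw [(Y.assoc F).moment_act] at h1
    have h2 := (h1.trans (hθm _)).trans (moment_assocUnit F X _)
    rwa [← hFγ, F.src_arr, hF.obj_eq, hF.obj_eq, ← Y.moment_act _ _ (e v)] at h2
  · rw [← hδ2 (i v), assocUnit_act F Y _ _ (e v) (by rw [hFγ]; exact hδ1 (i v))]
    exact (Y.assoc F).act_congr rfl (hFγ v).symm _

/-- For an object `(q₁, q₂, θ)` of the 2-fibre product over `U`, the isomorphism `θ` is locally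
induced by an isomorphism `α` of `G`-bundles, and `(id, α)` identifies the diagonal object of `q₁`
with `(q₁, q₂, θ)`. -/
theorem isEpi_diagonal_classifyingMap (hF : F.IsExtension) :
    IsEpi (diagonal F.classifyingMap) := by
  intro U q
  let q₁ := q.comp (fiberFst F.classifyingMap F.classifyingMap)
  let q₂ := q.comp (fiberSnd F.classifyingMap F.classifyingMap)
  let θ : q₁.comp F.classifyingMap ⟶ q₂.comp F.classifyingMap :=
    BasedCategory.whiskerLeft q (fiberArrow F.classifyingMap F.classifyingMap)
  choose V hV hb s s' hs hs' hp hp' hm hθ using exists_sections_of_assoc_hom hF (B := U)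
    (X := (bundleAt q₁ (repMk (𝟙 U))).bundle) (Y := (bundleAt q₂ (repMk (𝟙 U))).bundle)
    (θ := (bundleApp θ (repMk (𝟙 U))).tot) (bundleApp θ (repMk (𝟙 U))).continuous_tot
    (fun z ↦ (proj_bundleAt_comp F q₂ _ _).symm.trans
      (((bundleApp θ (repMk (𝟙 U))).proj_tot z).trans (proj_bundleAt_comp F q₁ _ _)))
    (bundleApp θ (repMk (𝟙 U))).moment_tot
  refine ⟨U, fun u ↦ TopCat.of (V u), fun u ↦ openIncl (V u),
    ofArrows_openIncl_mem_precoverage hV fun b ↦ ⟨b, hb b⟩, fun u ↦ ?_⟩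
  let σ := openIncl (V u)
  obtain ⟨t, ht, htp, hts⟩ := exists_restrict_section σ q₁ (hs u) (hp u)
  obtain ⟨t', ht', htp', hts'⟩ := exists_restrict_section σ q₂ (hs' u) (hp' u)
  obtain ⟨f, hf, hft⟩ := BundleObj.Hom.exists_of_section
    (X := bundleAt ((repMap σ).comp q₁) (repMk (𝟙 (TopCat.of (V u)))))
    (Y := bundleAt ((repMap σ).comp q₂) (repMk (𝟙 (TopCat.of (V u))))) (𝟙 _) ht htp ht' htp'
    fun v ↦ ((restrictMap σ q₂).moment_tot _).symm.trans ((congrArg _ (hts' v)).trans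
      ((hm u v).trans ((congrArg _ (hts v)).symm.trans ((restrictMap σ q₁).moment_tot _))))
  obtain ⟨α, hα⟩ := exists_natTrans_of_bundleHom (K := (repMap σ).comp q₁)
    (L := (repMap σ).comp q₂) f hf
  have hiso := G.allCartesian_classifying.isIso_natTrans α
  refine ⟨(repMap σ).comp q₁, nonempty_iso_diagonal ((repMap σ).comp q) α hiso ?_⟩
  -- Both transformations of associated bundles send the section `[t, 1]` to `[t', 1]`.
  refine natTrans_ext_of_section (K := ((repMap σ).comp q₁).comp F.classifyingMap)
    (L := ((repMap σ).comp q₂).comp F.classifyingMap)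
    (s := fun v ↦ assocUnit F (bundleAt ((repMap σ).comp q₁) _).bundle (t v)) (fun v ↦ htp v)
    fun v ↦ ?_
  refine (bundleApp_whiskerRight_assocUnit F α _ (t v)).trans
    ((congrArg (assocUnit F _) ((congrFun hα (t v)).trans (hft v))).trans ?_)
  refine (restrictMap σ (q₂.comp F.classifyingMap)).eq_of_proj_eq_of_tot_eq ?_ ?_
  · refine Eq.trans (htp' v) (Eq.symm ?_)
    exact (BundleObj.Hom.proj_tot (bundleApp (BasedCategory.whiskerLeft (repMap σ) θ)
      (repMk (𝟙 (TopCat.of (V u))))) _).trans (htp v)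
  · have h1 : (restrictMap σ (q₂.comp F.classifyingMap)).tot (assocUnit F _ (t' v)) = _ :=
      bundleMap_assocUnit F q₂ _ (t' v)
    have h2 : (restrictMap σ (q₁.comp F.classifyingMap)).tot (assocUnit F _ (t v)) = _ :=
      bundleMap_assocUnit F q₁ _ (t v)
    have h3 := bundleApp_naturality θ (toTerminal ((repMap σ).obj (repMk (𝟙 (TopCat.of (V u))))))
      (assocUnit F (bundleAt ((repMap σ).comp q₁) _).bundle (t v))
    refine h1.trans (Eq.trans ?_ h3)
    refine Eq.trans ?_ (congrArg (bundleApp θ (repMk (𝟙 U))).tot h2.symm)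
    refine (congrArg (assocUnit F _) (hts' v)).trans ((hθ u v).symm.trans ?_)
    exact congrArg (fun z ↦ (bundleApp θ (repMk (𝟙 U))).tot (assocUnit F _ z)) (hts v).symm

end Epi

theorem isGerbe_classifyingMap {H : TopGroupoid M} (F : TopGroupoid.Hom G H)
    (hF : F.IsExtension) : IsGerbe F.classifyingMap where
  source := isTopologicalStack_classifying G
  target := isTopologicalStack_classifying H
  isEpi := isEpi_classifyingMap F hF.obj_eq
  isEpi_diagonal := isEpi_diagonal_classifyingMap hF

end TopStack

theorem mainTheorem1 {M : Type u} [TopologicalSpace M] {G H : TopGroupoid M}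
    (F : TopGroupoid.Hom G H) (hF : F.IsExtension) :
    TopStack.IsGerbe F.classifyingMap :=
  TopStack.isGerbe_classifyingMap F hF
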